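/- **Theorem 3.6.** Let $n\in\mathbb N$, $\nu\ge 0$, let $T\subseteq\mathbb C$ be open, $\Delta(t)=\prod_{1\le i<j\le n}(t_i-t_j)$ and $m_\nu=\nu m(m-1)/2$. Assume: (i) $p$ is holomorphic on $T$, $q$ is holomorphic and symmetric on $T^n$, and $h$ is entire with $h(cx)=c^{\nu}h(x)$ for $\operatorname{Re}c>0$ and $h(-x)=h(x)$. (ii) $\mathscr P$ is a piecewise $C^1$ contour, independent of $N$, with finite or infinite endpoints $a,b$, and $(a,b)_{\mathscr P}\subseteq T$. (iii) $x_-\neq x_+$ are interior points of $\mathscr P$ with $p'(x_\pm)=0$ and $p_\pm:=p''(x_\pm)\ne0$. There is $x_0\in(a,b)_{\mathscr P}$ such that $\mathscr P$ passes through $x_-$, $x_0$, $x_+$ in this order. (iv) For some $N_0>0$ the integral $$I_N=\int_a^b\cdots\int_a^b \exp\Big\{-N\sum_{j=1}^n p(t_j)\Big\}\,h(\Delta(t))\,q(t)\,dt_1\cdots dt_n$$ along $\mathscr P$ converges absolutely at $N=N_0$. (v) $\operatorname{Re}\{p(x)-p(x_-)\}>0$ on $(a,x_0]_{\mathscr P}$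 except at the passage through $x_-$, and $\operatorname{Re}\{p(x)-p(x_+)\}>0$ on $[x_0,b)_{\mathscr P}$ except at the passage through $x_+$. The first quantity is bounded away from $0$ as $x\to a$ along $\mathscr P$, the second as $x\to b$. In a small disk around $x_\pm$ contained in $T$, let $w_\pm(x)=(x-x_\pm)(1+\cdots)$ be the conformal map with $w_\pm(x)^2=(p(x)-p(x_\pm))/(p_\pm/2)$. Choose points $\tau_{1,\pm}$ before and $\tau_{2,\pm}$ after $x_\pm$ on $\mathscr P$, on the part of $\mathscr P$ strictly after $x_0$ (sign $+$), respectively strictly before $x_0$ (sign $-$), such that $\mathscr P$ stays in the disk between them and the image of $w_\pm$ contains all $w$ with $|w|\le\max_i|w_\pm(\tau_{i,\pm})|$. Such choices exist. Let $L_{1,\pm}$ be the half-line through $w_\pm(\tau_{1,\pm})$ directed from infinity to $0$, and $L_{2,\pm}$ the half-line through $w_\pm(\tau_{2,\pm})$ directed from $0$ to infinity. For $0\le l\le n$ put $q_{l,+}=q(x_+,\dots,x_+,x_-,\dots,x_-)$ with $l$ entries $x_+$ and $n-l$ entries $x_-$, $$\Delta_{l,+}(w)=(x_+-x_-)^{l(n-l)}\prod_{1\le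 i<j\le l}(w_i-w_j)\prod_{l<i<j\le n}(w_i-w_j),$$ $$B_{l,+}=\int_{(L_{1,+}\cup L_{2,+})^{l}\times(L_{1,-}\cup L_{2,-})^{n-l}}\exp\Big\{-\frac{p_+}{2}\sum_{i=1}^{l}w_i^2-\frac{p_-}{2}\sum_{i=l+1}^{n}w_i^2\Big\}\,h(\Delta_{l,+}(w))\,dw_1\cdots dw_n .$$ Then, for every such choice, the integrals $B_{l,+}$ and, for all large $N$, the integrals $I_N$ converge absolutely, and as the real parameter $N\to\infty$ $$I_N=\sum_{l=0}^{n}\binom nl\exp\{-N(l\,p(x_+)+(n-l)\,p(x_-))\}\,N^{-(l_\nu+(n-l)_\nu+n)/2}\,R_l(N),$$ where $R_l(N)=q_{l,+}B_{l,+}\,(1+O(N^{-1/2}))$ if $q_{l,+}B_{l,+}\neq0$, and $R_l(N)=O(N^{-1/2})$ if $q_{l,+}B_{l,+}=0$. -/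

import Mathlib

open Set Filter Topology MeasureTheory Asymptotics

noncomputable section

/-- An oriented contour `(a, b)` in the complex plane without its endpoints, parametrized by the
open interval `(-∞, ∞)`.  Around every parameter it is `C¹` on the left and on the right, that is,
it is piecewise `C¹` on every compact interval.  The endpoints `a`, `b` are finite or infinite. -/
structure IsContour (γ : ℝ → ℂ) (a b : OnePoint ℂ) : Prop where
  piecewise_smooth : ∀ s : ℝ, ∃ δ > 0,
    ContDiffOn ℝ 1 γ (Icc (s - δ) s) ∧ ContDiffOn ℝ 1 γ (Icc s (s + δ))
  start_point : Tendsto (fun s => (γ s : OnePoint ℂ)) atBot (𝓝 a)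
  end_point : Tendsto (fun s => (γ s : OnePoint ℂ)) atTop (𝓝 b)

/-- The pull-back of `F(t) dt₁ ⋯ dtₙ` to parameters, the variable `tᵢ` running along `Γ i`. -/
def pullback {n : ℕ} (Γ : Fin n → ℝ → ℂ) (F : (Fin n → ℂ) → ℂ) (s : Fin n → ℝ) : ℂ :=
  F (fun i => Γ i (s i)) * ∏ i, deriv (Γ i) (s i)

/-- The `n`-fold contour integral `∫_{Γ₁} ⋯ ∫_{Γₙ} F(t) dt₁ ⋯ dtₙ`. -/
def contourIntegral {n : ℕ} (Γ : Fin n → ℝ → ℂ) (F : (Fin n → ℂ) → ℂ) : ℂ :=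
  ∫ s : Fin n → ℝ, pullback Γ F s

/-- The Vandermonde product `Δ(t) = ∏_{i < j} (tᵢ - tⱼ)`. -/
def vandermonde {n : ℕ} (t : Fin n → ℂ) : ℂ :=
  ∏ i, ∏ j ∈ Finset.Ioi i, (t i - t j)

/-- The integrand `exp(-N ∑ⱼ p(tⱼ)) h(Δ(t)) q(t)`. -/
def selbergIntegrand {n : ℕ} (p h : ℂ → ℂ) (q : (Fin n → ℂ) → ℂ) (N : ℝ) (t : Fin n → ℂ) : ℂ :=
  Complex.exp (-(N : ℂ) * ∑ j, p (t j)) * h (vandermonde t) * q t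

/-- `m_ν = ν m (m - 1) / 2`. -/
def nuPairs (ν m : ℝ) : ℝ := ν * m * (m - 1) / 2

/-- The point `(x₊, …, x₊, x₋, …, x₋)` with `l` entries `x₊` followed by `n - l` entries `x₋`. -/
def saddlePoint {n : ℕ} (l : ℕ) (xp xm : ℂ) : Fin n → ℂ :=
  fun i => if (i : ℕ) < l then xp else xm

/-- `(x₊ - x₋)^{l(n-l)} ∏_{i<j≤l} (wᵢ - wⱼ) ∏_{l<i<j} (wᵢ - wⱼ)`: the Vandermonde product with
each difference between the first `l` and the last `n - l` variables replaced by `x₊ - x₋`. -/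
def splitVandermonde {n : ℕ} (l : ℕ) (xp xm : ℂ) (w : Fin n → ℂ) : ℂ :=
  (xp - xm) ^ (l * (n - l)) *
    ∏ i : Fin n, ∏ j ∈ Finset.Ioi i, if (i : ℕ) < l ↔ (j : ℕ) < l then w i - w j else 1

/-- The local coordinate at a simple saddle point `x` of `p`: a conformal map `w` of the disk of
radius `ρ` around `x` with `w(z) = (z - x)(1 + ⋯)` and `w(z)² = (p(z) - p(x)) / (p''(x)/2)`. -/
structure IsSaddleCoordinate (T : Set ℂ) (p : ℂ → ℂ) (x : ℂ) (ρ : ℝ) (w : ℂ → ℂ) : Prop where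
  radius_pos : 0 < ρ
  ball_subset : Metric.ball x ρ ⊆ T
  holomorphic : DifferentiableOn ℂ w (Metric.ball x ρ)
  injective : InjOn w (Metric.ball x ρ)
  map_center : w x = 0
  deriv_center : deriv w x = 1
  sq_eq : ∀ z ∈ Metric.ball x ρ, w z ^ 2 = (p z - p x) / (deriv (deriv p) x / 2)

/-- `κ₁ = w(γ τ₁)` and `κ₂ = w(γ τ₂)` for a local coordinate `w` at the saddle point `γ s` and two
points of the contour close to it, one before and one after, with parameters in `J`.  The paths
from `γ τ₁` to `γ s` and from `γ s` to `γ τ₂` can be deformed, within the domain of `w`, to paths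
that `w` maps to the straight segments from `κ₁` to `0` and from `0` to `κ₂`. -/
def IsSaddleRays (T : Set ℂ) (p : ℂ → ℂ) (γ : ℝ → ℂ) (J : Set ℝ) (s : ℝ) (κ₁ κ₂ : ℂ) : Prop :=
  ∃ (ρ : ℝ) (w : ℂ → ℂ) (τ₁ τ₂ : ℝ),
    IsSaddleCoordinate T p (γ s) ρ w ∧ τ₁ < s ∧ s < τ₂ ∧ Icc τ₁ τ₂ ⊆ J ∧
    MapsTo γ (Icc τ₁ τ₂) (Metric.ball (γ s) ρ) ∧
    κ₁ = w (γ τ₁) ∧ κ₂ = w (γ τ₂) ∧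
    Metric.closedBall 0 (max ‖κ₁‖ ‖κ₂‖) ⊆ w '' Metric.ball (γ s) ρ

/-- The contour `L₁ ∪ L₂`: the half-line through `κ₁`, run from infinity to the origin, followed by
the half-line through `κ₂`, run from the origin to infinity. -/
def rayContour (κ₁ κ₂ : ℂ) (v : ℝ) : ℂ :=
  if v ≤ 0 then ((-v : ℝ) : ℂ) * κ₁ else (v : ℂ) * κ₂

/-- The first `l` variables run along `Γp`, the others along `Γm`. -/
def splitContours {n : ℕ} (l : ℕ) (Γp Γm : ℝ → ℂ) : Fin n → ℝ → ℂ :=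
  fun i => if (i : ℕ) < l then Γp else Γm

/-- The integrand of the Gaussian-type constant `B_{l,+}`, with `ap = p''(x₊)`, `am = p''(x₋)`. -/
def gaussIntegrand {n : ℕ} (h : ℂ → ℂ) (xp xm ap am : ℂ) (l : ℕ) (w : Fin n → ℂ) : ℂ :=
  Complex.exp (-∑ i : Fin n, (if (i : ℕ) < l then ap else am) / 2 * w i ^ 2) *
    h (splitVandermonde l xp xm w)

end

/-! An entire homogeneous function is a monomial `A * x ^ k`, with `k = ν` unless `A = 0`
(`homogeneous_entire_eq_monomial`). So `h (Δ)` is a constant times a power of a polynomial, and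
everything reduces to Laplace's method with a polynomial factor that vanishes at the saddle points.

Since `h` is even, the integrand is symmetric in the parameters. Cutting the contour at `s0` splits
the parameter space into `2 ^ n` regions, and those with the same number `l` of variables beyond
`s0` contribute equally, which gives the binomial coefficients (`integral_eq_sum_choose`). In such a
region each variable has its own saddle point. Outside a box around these the real part of the
exponent exceeds its saddle value by a fixed amount, so that part is exponentially small relative to
the saddle value.

On the box, Cauchy's theorem in each variable (`setIntegral_pullback_congr`) replaces the contour by
the image of two straight segments under the inverse of the local coordinate, where the exponent is
exactly quadratic. There the Vandermonde product equals its split version times `1 + O(‖u‖)`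
(`exists_splitVandermonde_factor`). Rescaling by `√N` extracts the power of `N`: the homogeneity of
the split product supplies the degree of `h`, the volume element supplies `n`. The factor `1 +
O(‖u‖)` becomes `1 + O(‖v‖ / √N)`, which is integrable against the Gaussian
(`exists_norm_localIntegral_sub_le`). All errors are bounds on a difference, so they yield a
relative error when the leading constant is nonzero and an absolute one otherwise. -/

/-! ### Homogeneous entire functions -/

/-- Scaling by `c = 2` alone suffices: comparing Taylor coefficients at `0` gives `2 ^ m * aₘ = 2 ^
ν * aₘ`, so `aₘ = 0` unless `m = ν`. -/
theorem homogeneous_entire_eq_monomial {h : ℂ → ℂ} {ν : ℝ} (hh : Differentiable ℂ h)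
    (hom : ∀ c x : ℂ, 0 < c.re → h (c * x) = c ^ (ν : ℂ) * h x) :
    ∃ (A : ℂ) (k : ℕ), (A = 0 ∨ (k : ℝ) = ν) ∧ ∀ x, h x = A * x ^ k := by
  have coeff : ∀ m : ℕ, iteratedDeriv m h 0 = 0 ∨ (m : ℝ) = ν := by
    intro m
    by_contra! hm
    have h1 : (fun x => h ((2 : ℂ) * x)) = fun x => (2 : ℂ) ^ (ν : ℂ) * h x :=
      funext fun x => hom 2 x (by norm_num)
    have h2 := iteratedDeriv_comp_const_mul (n := m) hh.contDiff (2 : ℂ)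
    have h3 : iteratedDeriv m (fun x => h ((2 : ℂ) * x)) 0 =
        (2 : ℂ) ^ (ν : ℂ) * iteratedDeriv m h 0 := by
      rw [h1, iteratedDeriv_const_mul _ hh.contDiff.contDiffAt]
    rw [h2] at h3
    simp only [mul_zero] at h3
    have h4 := mul_right_cancel₀ hm.1 h3
    have h5 := congrArg norm h4
    have h6 : ‖(2 : ℂ) ^ (ν : ℂ)‖ = (2 : ℝ) ^ ν := by
      have := Complex.norm_cpow_eq_rpow_re_of_pos (x := 2) (by norm_num) (ν : ℂ)
      simpa only [Complex.ofReal_ofNat, Complex.ofReal_re] using this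
    rw [h6, norm_pow, ← Real.rpow_natCast] at h5
    rw [Complex.norm_ofNat] at h5
    exact hm.2 ((Real.rpow_right_inj (by norm_num) (by norm_num)).mp h5)
  have key := fun z => Complex.taylorSeries_eq_of_entire' (f := h) 0 z hh
  by_cases hk : ∃ k : ℕ, (k : ℝ) = ν
  · obtain ⟨k, hk⟩ := hk
    refine ⟨((Nat.factorial k : ℂ))⁻¹ * iteratedDeriv k h 0, k, Or.inr hk, fun x => ?_⟩
    rw [← key x, tsum_eq_single k]
    · simp
    · intro m hm
      rcases coeff m with h0 | h0
      · simp [h0]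
      · exact absurd (by exact_mod_cast h0.trans hk.symm) hm
  · refine ⟨0, 0, Or.inl rfl, fun x => ?_⟩
    rw [← key x]
    have : ∀ m : ℕ, iteratedDeriv m h 0 = 0 := fun m =>
      (coeff m).resolve_right fun e => hk ⟨m, e⟩
    simp [this]

/-! ### Vandermonde products: symmetry, homogeneity, growth -/

theorem vandermonde_eq_det {n : ℕ} (t : Fin n → ℂ) :
    vandermonde t = (Matrix.vandermonde fun i => - t i).det := by
  rw [Matrix.det_vandermonde, vandermonde]
  refine Finset.prod_congr rfl fun i _ => Finset.prod_congr rfl fun j _ => ?_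
  ring

theorem vandermonde_comp_perm {n : ℕ} (σ : Equiv.Perm (Fin n)) (t : Fin n → ℂ) :
    vandermonde (fun i => t (σ i)) = vandermonde t ∨
      vandermonde (fun i => t (σ i)) = - vandermonde t := by
  have h1 : (Matrix.vandermonde fun i => - t (σ i)) =
      (Matrix.vandermonde fun i => - t i).submatrix σ id := by
    ext i j; simp [Matrix.vandermonde_apply]
  rw [vandermonde_eq_det, vandermonde_eq_det, h1, Matrix.det_permute]
  rcases Int.units_eq_one_or (Equiv.Perm.sign σ) with h | h <;> simp [h]

/-- Over natural number ranges the product can be cut at `l` with `Finset.prod_range_add`, which is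
how the two blocks are counted below. -/
theorem prod_pairs_eq_prod_range {n : ℕ} (f : ℕ → ℕ → ℂ) :
    ∏ i : Fin n, ∏ j ∈ Finset.Ioi i, f i j = ∏ j ∈ Finset.range n, ∏ i ∈ Finset.range j, f i j := by
  have h1 : ∏ i : Fin n, ∏ j ∈ Finset.Ioi i, f i j = ∏ j : Fin n, ∏ i ∈ Finset.Iio j, f i j :=
    Finset.prod_comm' (by simp)
  rw [h1, ← Fin.prod_univ_eq_prod_range (fun j => ∏ i ∈ Finset.range j, f i j) n]
  refine Finset.prod_congr rfl fun j _ => ?_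
  have : Finset.range (j : ℕ) = (Finset.Iio j).map Fin.valEmbedding := by
    rw [Fin.map_valEmbedding_Iio]; ext; simp
  rw [this, Finset.prod_map]; rfl

theorem sum_range_id_eq_choose_two (m : ℕ) : ∑ i ∈ Finset.range m, i = m.choose 2 := by
  rw [Finset.sum_range_id, Nat.choose_two_right]

theorem prod_same_block {n l : ℕ} (hl : l ≤ n) (c : ℂ) :
    ∏ i : Fin n, ∏ j ∈ Finset.Ioi i, (if (i : ℕ) < l ↔ (j : ℕ) < l then c else 1) =
      c ^ (l.choose 2 + (n - l).choose 2) := by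
  rw [prod_pairs_eq_prod_range (fun i j => if i < l ↔ j < l then c else 1)]
  obtain ⟨m, rfl⟩ := Nat.exists_eq_add_of_le hl
  rw [Finset.prod_range_add, pow_add, Nat.add_sub_cancel_left]
  congr 1
  · rw [← sum_range_id_eq_choose_two, ← Finset.prod_pow_eq_pow_sum]
    refine Finset.prod_congr rfl fun j hj => ?_
    rw [Finset.mem_range] at hj
    rw [Finset.prod_congr rfl (g := fun _ => c)]
    · simp
    · intro i hi
      rw [Finset.mem_range] at hi
      rw [if_pos (by omega)]
  · rw [← sum_range_id_eq_choose_two, ← Finset.prod_pow_eq_pow_sum]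
    refine Finset.prod_congr rfl fun j hj => ?_
    rw [Finset.prod_range_add, Finset.prod_eq_one, one_mul,
      Finset.prod_congr rfl (g := fun _ => c)]
    · simp
    · intro i hi
      rw [if_pos (by omega)]
    · intro i hi
      rw [Finset.mem_range] at hi
      rw [if_neg (by omega)]

theorem prod_cross_block {n l : ℕ} (hl : l ≤ n) (c : ℂ) :
    ∏ i : Fin n, ∏ j ∈ Finset.Ioi i, (if (i : ℕ) < l ↔ (j : ℕ) < l then 1 else c) =
      c ^ (l * (n - l)) := by
  rw [prod_pairs_eq_prod_range (fun i j => if i < l ↔ j < l then 1 else c)]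
  obtain ⟨m, rfl⟩ := Nat.exists_eq_add_of_le hl
  rw [Finset.prod_range_add, Nat.add_sub_cancel_left, Finset.prod_eq_one, one_mul,
    Finset.prod_congr rfl (g := fun _ => c ^ l)]
  · simp [pow_mul]
  · intro j hj
    have h1 : ∏ i ∈ Finset.range j, (if l + i < l ↔ l + j < l then 1 else c) = 1 :=
      Finset.prod_eq_one fun i hi => if_pos (by omega)
    rw [Finset.prod_range_add, h1, mul_one, Finset.prod_congr rfl (g := fun _ => c)]
    · simp
    · intro i hi
      rw [Finset.mem_range] at hi
      rw [if_neg (by omega)]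
  · intro j hj
    rw [Finset.mem_range] at hj
    refine Finset.prod_eq_one fun i hi => ?_
    rw [Finset.mem_range] at hi
    rw [if_pos (by omega)]

theorem splitVandermonde_smul {n l : ℕ} (hl : l ≤ n) (xp xm c : ℂ) (w : Fin n → ℂ) :
    splitVandermonde l xp xm (fun i => c * w i) =
      c ^ (l.choose 2 + (n - l).choose 2) * splitVandermonde l xp xm w := by
  rw [splitVandermonde, splitVandermonde, ← prod_same_block hl, mul_left_comm,
    ← Finset.prod_mul_distrib]
  congr 1
  refine Finset.prod_congr rfl fun i _ => ?_
  rw [← Finset.prod_mul_distrib]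
  refine Finset.prod_congr rfl fun j _ => ?_
  split_ifs <;> ring

/-- Identifies the exponent of the asymptotic formula with the degree of homogeneity of `h` composed
with the split Vandermonde product. -/
theorem nuPairs_eq_choose {n l k : ℕ} (hl : l ≤ n) :
    nuPairs k l + nuPairs k ((n : ℝ) - l) =
      (((l.choose 2 + (n - l).choose 2) * k : ℕ) : ℝ) := by
  rw [nuPairs, nuPairs]
  push_cast
  rw [Nat.cast_choose_two, Nat.cast_choose_two, Nat.cast_sub hl]
  ring

/-- A bound in product form, from `‖a - b‖ ≤ (1 + ‖a‖) * (1 + ‖b‖)`, so that integrability against a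
Gaussian reduces to one variable. -/
theorem norm_splitVandermonde_le {n : ℕ} (l : ℕ) (xp xm : ℂ) :
    ∃ (C : ℝ) (M : ℕ), 0 ≤ C ∧ ∀ w : Fin n → ℂ,
      ‖splitVandermonde l xp xm w‖ ≤ C * (∏ i, (1 + ‖w i‖)) ^ M := by
  refine ⟨‖(xp - xm) ^ (l * (n - l))‖, ∑ i : Fin n, (Finset.Ioi i).card, norm_nonneg _,
    fun w => ?_⟩
  have h1 : ∀ i, 1 ≤ 1 + ‖w i‖ := fun i => by linarith [norm_nonneg (w i)]
  have hD : 1 ≤ ∏ i, (1 + ‖w i‖) := Finset.one_le_prod fun i _ => h1 i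
  rw [splitVandermonde, norm_mul]
  gcongr
  rw [norm_prod, ← Finset.prod_pow_eq_pow_sum]
  refine Finset.prod_le_prod (fun _ _ => norm_nonneg _) fun i _ => ?_
  rw [norm_prod, ← Finset.prod_const]
  refine Finset.prod_le_prod (fun _ _ => norm_nonneg _) fun j hj => ?_
  split_ifs
  · have hij : i ≠ j := (Finset.mem_Ioi.mp hj).ne
    calc ‖w i - w j‖ ≤ (1 + ‖w i‖) * (1 + ‖w j‖) := by
          nlinarith [norm_sub_le (w i) (w j), norm_nonneg (w i), norm_nonneg (w j),
            mul_nonneg (norm_nonneg (w i)) (norm_nonneg (w j))]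
      _ = ∏ m ∈ {i, j}, (1 + ‖w m‖) := by rw [Finset.prod_pair hij]
      _ ≤ ∏ m, (1 + ‖w m‖) :=
          Finset.prod_le_prod_of_subset_of_one_le (Finset.subset_univ _)
            (fun m _ => by linarith [h1 m]) fun m _ _ => h1 m
  · simpa using hD

/-! ### Local coordinates at simple saddle points -/

theorem exists_factor_of_critical_point {T : Set ℂ} {p : ℂ → ℂ} {x : ℂ} (hT : IsOpen T)
    (hp : DifferentiableOn ℂ p T) (hx : x ∈ T) (h1 : deriv p x = 0) :
    ∃ g : ℂ → ℂ, DifferentiableOn ℂ g T ∧ (∀ z, p z = p x + (z - x) ^ 2 * g z) ∧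
      deriv (deriv p) x = 2 * g x := by
  have hxT : T ∈ 𝓝 x := hT.mem_nhds hx
  set g := dslope (dslope p x) x with hg
  have hgd : DifferentiableOn ℂ g T := by
    rw [hg, Complex.differentiableOn_dslope hxT, Complex.differentiableOn_dslope hxT]
    exact hp
  have hpg : ∀ z, p z = p x + (z - x) ^ 2 * g z := by
    intro z
    have e1 := sub_smul_dslope p x z
    have e2 := sub_smul_dslope (dslope p x) x z
    rw [dslope_same, h1, sub_zero] at e2
    rw [← e2] at e1
    simp only [smul_eq_mul] at e1
    linear_combination -e1
  refine ⟨g, hgd, hpg, ?_⟩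
  have hd : deriv p =ᶠ[𝓝 x] fun z => (z - x) * (2 * g z + (z - x) * deriv g z) := by
    filter_upwards [hxT] with z hz
    have hgz : HasDerivAt g (deriv g z) z :=
      (hgd.differentiableAt (hT.mem_nhds hz)).hasDerivAt
    have h3 : HasDerivAt (fun z => p x + (z - x) ^ 2 * g z)
        ((z - x) * (2 * g z + (z - x) * deriv g z)) z := by
      have := ((((hasDerivAt_id z).sub_const x).pow 2).mul hgz).const_add (p x)
      refine this.congr_deriv ?_
      simp; ring
    rw [← h3.deriv]
    congr 1
    exact funext hpg
  rw [hd.deriv_eq]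
  have hgx : DifferentiableAt ℂ g x := hgd.differentiableAt hxT
  have hgx' : DifferentiableAt ℂ (deriv g) x := (hgd.deriv hT).differentiableAt hxT
  have h4 : DifferentiableAt ℂ (fun z => 2 * g z + (z - x) * deriv g z) x := by fun_prop
  have := ((hasDerivAt_id x).sub_const x).mul h4.hasDerivAt
  refine (this.congr_deriv ?_).deriv
  simp

/-- With `p z = p x + (z - x) ^ 2 * g z` and `g x ≠ 0`, the coordinate is `(z - x) * √(g z / g x)`.
The principal root is holomorphic near `x` because the quotient is close to `1`. -/
theorem exists_isSaddleCoordinate {T : Set ℂ} {p : ℂ → ℂ} {x : ℂ} (hT : IsOpen T)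
    (hp : DifferentiableOn ℂ p T) (hx : x ∈ T) (h1 : deriv p x = 0)
    (h2 : deriv (deriv p) x ≠ 0) : ∃ (ρ : ℝ) (w : ℂ → ℂ), IsSaddleCoordinate T p x ρ w := by
  obtain ⟨g, hg, hpg, hpp⟩ := exists_factor_of_critical_point hT hp hx h1
  have hgx : g x ≠ 0 := by
    intro h0; rw [h0, mul_zero] at hpp; exact h2 hpp
  have hcont : ContinuousAt (fun z => g z / g x) x :=
    ((hg.differentiableAt (hT.mem_nhds hx)).continuousAt).div_const _
  have hslit : ∀ᶠ z in 𝓝 x, g z / g x ∈ Complex.slitPlane := by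
    refine hcont.eventually_mem (Complex.isOpen_slitPlane.mem_nhds ?_)
    rw [div_self hgx]
    exact Complex.one_mem_slitPlane
  set w : ℂ → ℂ := fun z => (z - x) * Complex.exp (Complex.log (g z / g x) / 2) with hw
  have hdiff : ∀ z ∈ T, g z / g x ∈ Complex.slitPlane → DifferentiableAt ℂ w z := by
    intro z hz hs
    have hgz := hg.differentiableAt (hT.mem_nhds hz)
    have h3 := (hgz.div_const (g x)).clog hs
    exact ((differentiableAt_id.sub_const x).mul ((h3.div_const 2).cexp))
  have hderiv : HasDerivAt w 1 x := by
    have hgz := hg.differentiableAt (hT.mem_nhds hx)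
    have h3 := (hgz.div_const (g x)).clog hslit.self_of_nhds
    have h4 := ((hasDerivAt_id x).sub_const x).mul ((h3.div_const 2).cexp).hasDerivAt
    refine h4.congr_deriv ?_
    simp [div_self hgx]
  have han : AnalyticAt ℂ w x := by
    rw [Complex.analyticAt_iff_eventually_differentiableAt]
    filter_upwards [hslit, hT.mem_nhds hx] with z hz hzT using hdiff z hzT hz
  have hstrict : HasStrictDerivAt w 1 x := by
    have := han.hasStrictDerivAt
    rwa [hderiv.deriv] at this
  have hinj := hstrict.hasStrictFDerivAt_equiv (one_ne_zero) |>.eventually_left_inverse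
  obtain ⟨ρ, hρ, hball⟩ := Metric.eventually_nhds_iff_ball.mp
    ((hslit.and (hT.mem_nhds hx)).and hinj)
  refine ⟨ρ, w, hρ, fun z hz => (hball z hz).1.2, fun z hz => ?_, fun z hz y hy e => ?_, ?_,
    hderiv.deriv, fun z hz => ?_⟩
  · exact (hdiff z (hball z hz).1.2 (hball z hz).1.1).differentiableWithinAt
  · rw [← (hball z hz).2, ← (hball y hy).2, e]
  · simp [hw]
  · have hne : g z / g x ≠ 0 := Complex.slitPlane_ne_zero (hball z hz).1.1
    rw [hw, mul_pow, ← Complex.exp_nat_mul, hpp, hpg z]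
    have : ((2 : ℕ) : ℂ) * (Complex.log (g z / g x) / 2) = Complex.log (g z / g x) := by
      push_cast; ring
    rw [this, Complex.exp_log hne]
    field_simp
    ring

/-- `t` is a holomorphic inverse, on the open set `V`, of a local coordinate at the saddle
point `x` of `p`. -/
structure IsSaddleInverse (p : ℂ → ℂ) (x : ℂ) (ρ : ℝ) (V : Set ℂ) (t : ℂ → ℂ) : Prop where
  isOpen : IsOpen V
  zero_mem : (0 : ℂ) ∈ V
  holomorphic : DifferentiableOn ℂ t V
  mapsTo : MapsTo t V (Metric.ball x ρ)
  map_zero : t 0 = x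
  deriv_zero : deriv t 0 = 1
  apply_sub : ∀ u ∈ V, p (t u) - p x = deriv (deriv p) x / 2 * u ^ 2

/-- The open mapping theorem makes the set-theoretic inverse continuous. It is differentiable
wherever `deriv w` is nonzero, and the remaining points are isolated, hence removable singularities.
-/
theorem IsSaddleCoordinate.exists_inverse {T : Set ℂ} {p : ℂ → ℂ} {x : ℂ} {ρ : ℝ} {w : ℂ → ℂ}
    (hw : IsSaddleCoordinate T p x ρ w) (h2 : deriv (deriv p) x ≠ 0) :
    ∃ t : ℂ → ℂ, IsSaddleInverse p x ρ (w '' Metric.ball x ρ) t ∧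
      ∀ z ∈ Metric.ball x ρ, t (w z) = z := by
  have hxb : x ∈ Metric.ball x ρ := Metric.mem_ball_self hw.radius_pos
  have han : AnalyticOnNhd ℂ w (Metric.ball x ρ) :=
    hw.holomorphic.analyticOnNhd Metric.isOpen_ball
  have hpre : IsPreconnected (Metric.ball x ρ) := (convex_ball x ρ).isPreconnected
  have hopen : ∀ s ⊆ Metric.ball x ρ, IsOpen s → IsOpen (w '' s) := by
    refine (han.is_constant_or_isOpen hpre).resolve_left ?_
    rintro ⟨c, hc⟩
    have : w =ᶠ[𝓝 x] fun _ => c := by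
      filter_upwards [Metric.isOpen_ball.mem_nhds hxb] with z hz using hc z hz
    have h := this.deriv_eq
    rw [hw.deriv_center, deriv_const] at h
    exact one_ne_zero h
  set t := Function.invFunOn w (Metric.ball x ρ) with ht
  have hleft : ∀ z ∈ Metric.ball x ρ, t (w z) = z := fun z hz =>
    hw.injective.leftInvOn_invFunOn hz
  have hright : ∀ u ∈ w '' Metric.ball x ρ, w (t u) = u := fun u hu =>
    Function.invFunOn_eq hu
  have hmaps : MapsTo t (w '' Metric.ball x ρ) (Metric.ball x ρ) := fun u hu =>
    Function.invFunOn_mem hu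
  have hV : IsOpen (w '' Metric.ball x ρ) := hopen _ Subset.rfl Metric.isOpen_ball
  have hcont : ∀ z ∈ Metric.ball x ρ, ContinuousAt t (w z) := by
    intro z hz
    rw [ContinuousAt, hleft z hz]
    intro U hU
    obtain ⟨W, hWU, hWo, hzW⟩ := mem_nhds_iff.mp (inter_mem hU (Metric.isOpen_ball.mem_nhds hz))
    refine mem_map.mpr (mem_of_superset
      ((hopen W (fun y hy => (hWU hy).2) hWo).mem_nhds (mem_image_of_mem w hzW)) ?_)
    rintro _ ⟨y, hy, rfl⟩
    rw [mem_preimage, hleft y (hWU hy).2]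
    exact (hWU hy).1
  have hdiff_ne : ∀ z ∈ Metric.ball x ρ, deriv w z ≠ 0 → DifferentiableAt ℂ t (w z) := by
    intro z hz hne
    have hwz : HasDerivAt w (deriv w z) (t (w z)) := by
      rw [hleft z hz]
      exact (hw.holomorphic.differentiableAt (Metric.isOpen_ball.mem_nhds hz)).hasDerivAt
    refine (HasDerivAt.of_local_left_inverse (hcont z hz) hwz hne ?_).differentiableAt
    filter_upwards [hV.mem_nhds (mem_image_of_mem w hz)] with u hu using hright u hu
  have hdan : AnalyticOnNhd ℂ (deriv w) (Metric.ball x ρ) := han.deriv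
  have hiso : ∀ z ∈ Metric.ball x ρ, ∀ᶠ y in 𝓝[≠] z, deriv w y ≠ 0 := by
    intro z hz
    refine (hdan z hz).eventually_eq_zero_or_eventually_ne_zero.resolve_left fun h0 => ?_
    have := hdan.eqOn_zero_of_preconnected_of_eventuallyEq_zero hpre hz h0 hxb
    rw [hw.deriv_center] at this
    exact one_ne_zero this
  have hdiff : ∀ z ∈ Metric.ball x ρ, DifferentiableAt ℂ t (w z) := by
    intro z hz
    -- `t` carries a punctured neighbourhood of `w z` into one of `z`, where `deriv w` does not
    -- vanish.
    refine (Complex.analyticAt_of_differentiable_on_punctured_nhds_of_continuousAt ?_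
      (hcont z hz)).differentiableAt
    have h3 : Tendsto t (𝓝[≠] (w z)) (𝓝[≠] z) := by
      refine tendsto_nhdsWithin_iff.mpr ⟨?_, ?_⟩
      · have := (hcont z hz).tendsto
        rw [hleft z hz] at this
        exact this.mono_left nhdsWithin_le_nhds
      · filter_upwards [self_mem_nhdsWithin, nhdsWithin_le_nhds
          (hV.mem_nhds (mem_image_of_mem w hz))] with u hu huV e
        rw [mem_singleton_iff] at e
        apply hu
        rw [mem_singleton_iff, ← hright u huV, e]
    filter_upwards [h3.eventually (hiso z hz), nhdsWithin_le_nhds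
      (hV.mem_nhds (mem_image_of_mem w hz))] with u hu huV
    rw [← hright u huV]
    exact hdiff_ne _ (hmaps huV) hu
  have ht0 : t 0 = x := by rw [← hw.map_center, hleft x hxb]
  refine ⟨t, ⟨hV, ⟨x, hxb, hw.map_center⟩, ?_, hmaps, ht0, ?_, ?_⟩, hleft⟩
  · rintro _ ⟨z, hz, rfl⟩
    exact (hdiff z hz).differentiableWithinAt
  · have h4 : HasDerivAt t (deriv t 0) (w x) := by
      rw [hw.map_center, ← hw.map_center]
      exact (hdiff x hxb).hasDerivAt
    have h5 : HasDerivAt w 1 x := by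
      rw [← hw.deriv_center]
      exact (hw.holomorphic.differentiableAt (Metric.isOpen_ball.mem_nhds hxb)).hasDerivAt
    have h6 := h4.comp x h5
    have h7 : HasDerivAt (t ∘ w) 1 x := by
      refine (hasDerivAt_id x).congr_of_eventuallyEq ?_
      filter_upwards [Metric.isOpen_ball.mem_nhds hxb] with z hz using hleft z hz
    simpa using h6.unique h7
  · intro u hu
    have := hw.sq_eq _ (hmaps hu)
    rw [hright u hu] at this
    rw [this]
    field_simp

theorem exists_isSaddleRays {T : Set ℂ} {p : ℂ → ℂ} {γ : ℝ → ℂ} {J : Set ℝ} {s : ℝ}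
    (hT : IsOpen T) (hp : DifferentiableOn ℂ p T) (hx : γ s ∈ T) (h1 : deriv p (γ s) = 0)
    (h2 : deriv (deriv p) (γ s) ≠ 0) (hγ : Continuous γ) (hJ : J ∈ 𝓝 s) :
    ∃ κ₁ κ₂ : ℂ, IsSaddleRays T p γ J s κ₁ κ₂ := by
  obtain ⟨ρ, w, hw⟩ := exists_isSaddleCoordinate hT hp hx h1 h2
  obtain ⟨t, ht, -⟩ := hw.exists_inverse h2
  obtain ⟨r, hr, hrV⟩ := Metric.nhds_basis_closedBall.mem_iff.mp (ht.isOpen.mem_nhds ht.zero_mem)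
  have hball : Metric.ball (γ s) ρ ∈ 𝓝 (γ s) := Metric.ball_mem_nhds _ hw.radius_pos
  have hwc : ContinuousAt w (γ s) := (hw.holomorphic.differentiableAt hball).continuousAt
  have hwγ : ∀ᶠ u in 𝓝 s, ‖w (γ u)‖ ≤ r := by
    have h3 : ContinuousAt (fun u => w (γ u)) s :=
      ContinuousAt.comp (g := w) hwc hγ.continuousAt
    have h4 := h3.norm
    refine h4.eventually_le_const ?_
    change ‖w (γ s)‖ < r
    rw [hw.map_center]
    simpa using hr
  obtain ⟨δ, hδ, hd⟩ := Metric.nhds_basis_closedBall.mem_iff.mp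
    (inter_mem hJ (inter_mem (hγ.continuousAt.preimage_mem_nhds hball) hwγ))
  rw [Real.closedBall_eq_Icc] at hd
  refine ⟨_, _, ρ, w, s - δ, s + δ, hw, by linarith, by linarith, fun u hu => (hd hu).1,
    fun u hu => (hd hu).2.1, rfl, rfl, ?_⟩
  refine (Metric.closedBall_subset_closedBall (max_le ?_ ?_)).trans hrV
  · exact (hd (left_mem_Icc.mpr (by linarith))).2.2
  · exact (hd (right_mem_Icc.mpr (by linarith))).2.2

/-! ### Piecewise smooth paths and contours -/

/-- A piecewise smooth path `Γ` in `U`, with parameters in `[α, β]`. -/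
structure IsPathIn (Γ : ℝ → ℂ) (α β : ℝ) (U : Set ℂ) : Prop where
  le : α ≤ β
  continuousOn : ContinuousOn Γ (Icc α β)
  mapsTo : MapsTo Γ (Icc α β) U
  differentiable : ∃ D : Set ℝ, D.Countable ∧ ∀ s ∈ Ioo α β \ D, DifferentiableAt ℝ Γ s
  integrable_deriv : IntegrableOn (deriv Γ) (Icc α β)

section Contour

variable {γ : ℝ → ℂ} {a b : OnePoint ℂ}

theorem IsContour.continuous (hγ : IsContour γ a b) : Continuous γ := by
  refine continuous_iff_continuousAt.mpr fun s => ?_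
  obtain ⟨δ, hδ, h1, h2⟩ := hγ.piecewise_smooth s
  refine continuousAt_iff_continuous_left_right.mpr ⟨?_, ?_⟩
  · exact (h1.continuousOn s (right_mem_Icc.mpr (by linarith))).mono_of_mem_nhdsWithin
      (Icc_mem_nhdsLE (by linarith))
  · exact (h2.continuousOn s (left_mem_Icc.mpr (by linarith))).mono_of_mem_nhdsWithin
      (Icc_mem_nhdsGE (by linarith))

/-- Inside the interval attached to `s` only `s` itself can be exceptional, and countably many of
these intervals cover the line. -/
theorem IsContour.countable_not_differentiableAt (hγ : IsContour γ a b) :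
    {s | ¬ DifferentiableAt ℝ γ s}.Countable := by
  choose δ hδ h1 h2 using hγ.piecewise_smooth
  obtain ⟨t, ht, hU⟩ := TopologicalSpace.countable_cover_nhds
    (f := fun s => Ioo (s - δ s) (s + δ s)) fun s => Ioo_mem_nhds (by linarith [hδ s])
      (by linarith [hδ s])
  refine ht.mono fun u hu => ?_
  have hu' : u ∈ ⋃ x ∈ t, Ioo (x - δ x) (x + δ x) := hU ▸ mem_univ u
  simp only [mem_iUnion] at hu'
  obtain ⟨s, hs, hus⟩ := hu'
  rcases lt_trichotomy u s with h | rfl | h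
  · exact absurd (((h1 s).differentiableOn one_ne_zero).differentiableAt
      (Icc_mem_nhds hus.1 h)) hu
  · exact hs
  · exact absurd (((h2 s).differentiableOn one_ne_zero).differentiableAt
      (Icc_mem_nhds h hus.2)) hu

theorem integrableOn_deriv_of_contDiffOn {Γ : ℝ → ℂ} {α β : ℝ}
    (h : ContDiffOn ℝ 1 Γ (Icc α β)) :
    IntegrableOn (deriv Γ) (Icc α β) := by
  rcases lt_or_ge α β with hab | hab
  · have h1 : IntegrableOn (derivWithin Γ (Icc α β)) (Icc α β) :=
      (h.continuousOn_derivWithin (uniqueDiffOn_Icc hab) le_rfl).integrableOn_Icc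
    rw [integrableOn_Icc_iff_integrableOn_Ioo] at h1 ⊢
    refine h1.congr_fun (fun s hs => ?_) measurableSet_Ioo
    exact derivWithin_of_mem_nhds (Icc_mem_nhds hs.1 hs.2)
  · refine IntegrableOn.of_measure_zero ?_
    rw [Real.volume_Icc, ENNReal.ofReal_eq_zero]
    linarith

theorem IsContour.locallyIntegrable_deriv (hγ : IsContour γ a b) :
    LocallyIntegrable (deriv γ) := by
  intro s
  obtain ⟨δ, hδ, h1, h2⟩ := hγ.piecewise_smooth s
  refine ⟨Icc (s - δ) s ∪ Icc s (s + δ), ?_, ?_⟩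
  · rw [Icc_union_Icc_eq_Icc (by linarith) (by linarith)]
    exact Icc_mem_nhds (by linarith) (by linarith)
  · exact (integrableOn_deriv_of_contDiffOn h1).union (integrableOn_deriv_of_contDiffOn h2)

theorem IsContour.isPathIn (hγ : IsContour γ a b) {α β : ℝ} {U : Set ℂ} (hαβ : α ≤ β)
    (hU : MapsTo γ (Icc α β) U) : IsPathIn γ α β U where
  le := hαβ
  continuousOn := hγ.continuous.continuousOn
  mapsTo := hU
  differentiable := ⟨_, hγ.countable_not_differentiableAt, fun _ hs => not_not.mp hs.2⟩
  integrable_deriv := hγ.locallyIntegrable_deriv.integrableOn_isCompact isCompact_Icc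

end Contour

/-! ### Cauchy's theorem for iterated contour integrals -/

section PathIndependence

theorem IsPathIn.integral_eq {Γ : ℝ → ℂ} {α β : ℝ} {U : Set ℂ} (hΓ : IsPathIn Γ α β U)
    {G f : ℂ → ℂ} (hf : ContinuousOn f U) (hG : ∀ z ∈ U, HasDerivAt G (f z) z) :
    ∫ s in Icc α β, f (Γ s) * deriv Γ s = G (Γ β) - G (Γ α) := by
  obtain ⟨D, hD, hd⟩ := hΓ.differentiable
  have hGU : ContinuousOn G U := fun z hz => (hG z hz).continuousAt.continuousWithinAt
  rw [integral_Icc_eq_integral_Ioc, ← intervalIntegral.integral_of_le hΓ.le]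
  refine integral_eq_of_hasDerivAt_off_countable_of_le (fun s => G (Γ s)) _
    hΓ.le hD (hGU.comp hΓ.continuousOn hΓ.mapsTo) (fun s hs => ?_) ?_
  · refine ((hG _ (hΓ.mapsTo (Ioo_subset_Icc_self hs.1))).scomp s
      (hd s hs).hasDerivAt).congr_deriv ?_
    rw [smul_eq_mul, mul_comm]
  · rw [intervalIntegrable_iff_integrableOn_Icc_of_le hΓ.le]
    exact hΓ.integrable_deriv.continuousOn_mul (hf.comp hΓ.continuousOn hΓ.mapsTo) isCompact_Icc

/-- A holomorphic function on a disk has a primitive there, and the integral is its increment. -/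
theorem IsPathIn.integral_congr {Γ Γ' : ℝ → ℂ} {α β α' β' r : ℝ} {c : ℂ}
    (hΓ : IsPathIn Γ α β (Metric.ball c r)) (hΓ' : IsPathIn Γ' α' β' (Metric.ball c r))
    (h0 : Γ α = Γ' α') (h1 : Γ β = Γ' β') {f : ℂ → ℂ}
    (hf : DifferentiableOn ℂ f (Metric.ball c r)) :
    ∫ s in Icc α β, f (Γ s) * deriv Γ s = ∫ s in Icc α' β', f (Γ' s) * deriv Γ' s := by
  obtain ⟨G, hG⟩ := hf.isExactOn_ball
  rw [hΓ.integral_eq hf.continuousOn hG, hΓ'.integral_eq hf.continuousOn hG, h0, h1]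

variable {n : ℕ}

theorem continuousOn_comp_paths {Γ : Fin n → ℝ → ℂ} {α β : Fin n → ℝ} {U : Fin n → Set ℂ}
    (hΓ : ∀ i, IsPathIn (Γ i) (α i) (β i) (U i)) :
    ContinuousOn (fun s : Fin n → ℝ => fun i => Γ i (s i)) (univ.pi fun i => Icc (α i) (β i)) := by
  refine continuousOn_pi.mpr fun i => ?_
  exact (hΓ i).continuousOn.comp (continuous_apply i).continuousOn fun s hs => hs i (mem_univ i)

theorem integrable_pullback_pi {Γ : Fin n → ℝ → ℂ} {α β : Fin n → ℝ} {U : Fin n → Set ℂ}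
    (hΓ : ∀ i, IsPathIn (Γ i) (α i) (β i) (U i)) {F : (Fin n → ℂ) → ℂ}
    (hF : ContinuousOn F {t | ∀ i, t i ∈ U i}) :
    IntegrableOn (pullback Γ F) (univ.pi fun i => Icc (α i) (β i)) := by
  have hK : IsCompact (univ.pi fun i => Icc (α i) (β i)) :=
    isCompact_univ_pi fun i => isCompact_Icc
  refine IntegrableOn.continuousOn_mul (g := fun s => F fun i => Γ i (s i)) ?_ ?_ hK
  · exact hF.comp (continuousOn_comp_paths hΓ) fun s hs i => (hΓ i).mapsTo (hs i (mem_univ i))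
  · rw [IntegrableOn, volume_pi, Measure.restrict_pi_pi]
    exact Integrable.fintype_prod fun i => (hΓ i).integrable_deriv

theorem integrable_pullback_cons {Γ₀ : ℝ → ℂ} {α₀ β₀ : ℝ} {U₀ : Set ℂ}
    (hΓ₀ : IsPathIn Γ₀ α₀ β₀ U₀) {Γ : Fin n → ℝ → ℂ} {α β : Fin n → ℝ} {U : Fin n → Set ℂ}
    (hΓ : ∀ i, IsPathIn (Γ i) (α i) (β i) (U i)) {F : (Fin (n + 1) → ℂ) → ℂ}
    (hF : ContinuousOn F {t | t 0 ∈ U₀ ∧ ∀ i : Fin n, t i.succ ∈ U i}) :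
    Integrable (fun x : ℝ × (Fin n → ℝ) => F (Fin.cons (Γ₀ x.1) fun i => Γ i (x.2 i)) *
        (deriv Γ₀ x.1 * ∏ i, deriv (Γ i) (x.2 i)))
      ((volume.restrict (Icc α₀ β₀)).prod (volume.restrict (univ.pi fun i => Icc (α i) (β i)))) := by
  have hK : IsCompact (Icc α₀ β₀ ×ˢ (univ.pi fun i => Icc (α i) (β i))) :=
    isCompact_Icc.prod (isCompact_univ_pi fun i => isCompact_Icc)
  have h1 : Integrable (fun x : ℝ × (Fin n → ℝ) => deriv Γ₀ x.1 * ∏ i, deriv (Γ i) (x.2 i))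
      ((volume.restrict (Icc α₀ β₀)).prod (volume.restrict (univ.pi fun i => Icc (α i) (β i)))) := by
    have h2 : Integrable (fun y : Fin n → ℝ => ∏ i, deriv (Γ i) (y i))
        (volume.restrict (univ.pi fun i => Icc (α i) (β i))) := by
      rw [volume_pi, Measure.restrict_pi_pi]
      exact Integrable.fintype_prod fun i => (hΓ i).integrable_deriv
    exact Integrable.mul_prod (f := deriv Γ₀) hΓ₀.integrable_deriv h2
  rw [Measure.prod_restrict, ← IntegrableOn] at h1 ⊢
  refine IntegrableOn.continuousOn_mul
    (g := fun x : ℝ × (Fin n → ℝ) => F (Fin.cons (Γ₀ x.1) fun i => Γ i (x.2 i))) ?_ h1 hK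
  refine hF.comp ?_ fun x hx => ⟨by simpa using hΓ₀.mapsTo hx.1,
    fun i => by simpa using (hΓ i).mapsTo (hx.2 i (mem_univ i))⟩
  refine continuousOn_pi.mpr fun i => ?_
  refine Fin.cases ?_ (fun i => ?_) i
  · simp only [Fin.cons_zero]
    exact hΓ₀.continuousOn.comp continuous_fst.continuousOn fun x hx => (mem_prod.mp hx).1
  · simp only [Fin.cons_succ]
    exact (hΓ i).continuousOn.comp ((continuous_apply i).comp continuous_snd).continuousOn
      fun x hx => hx.2 i (mem_univ i)

theorem setIntegral_pullback_succ (Γ : Fin (n + 1) → ℝ → ℂ) (α β : Fin (n + 1) → ℝ)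
    (F : (Fin (n + 1) → ℂ) → ℂ) :
    ∫ s in univ.pi fun i => Icc (α i) (β i), pullback Γ F s =
      ∫ x, F (Fin.cons (Γ 0 x.1) fun i => Γ i.succ (x.2 i)) *
        (deriv (Γ 0) x.1 * ∏ i : Fin n, deriv (Γ i.succ) (x.2 i))
        ∂((volume.restrict (Icc (α 0) (β 0))).prod
          (volume.restrict (univ.pi fun i : Fin n => Icc (α i.succ) (β i.succ)))) := by
  rw [volume_pi, volume_pi, Measure.restrict_pi_pi, Measure.restrict_pi_pi,
    ← ((measurePreserving_piFinSuccAbove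
      (fun i => volume.restrict (Icc (α i) (β i))) 0).symm).integral_comp']
  refine integral_congr_ae (Eventually.of_forall fun x => ?_)
  simp only [pullback, MeasurableEquiv.piFinSuccAbove_symm_apply, Fin.insertNthEquiv,
    Fin.prod_univ_succ, Fin.insertNth_zero, Equiv.coe_fn_mk, Fin.cons_succ, Fin.cons_zero]
  congr 2
  funext i
  refine Fin.cases ?_ (fun i => ?_) i <;> simp

/-- An iterated contour integral of a holomorphic function over paths in disks depends only on the
endpoints of the paths. -/
theorem setIntegral_pullback_congr {c : Fin n → ℂ} {r : Fin n → ℝ}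
    {Γ Γ' : Fin n → ℝ → ℂ} {α β α' β' : Fin n → ℝ}
    (hΓ : ∀ i, IsPathIn (Γ i) (α i) (β i) (Metric.ball (c i) (r i)))
    (hΓ' : ∀ i, IsPathIn (Γ' i) (α' i) (β' i) (Metric.ball (c i) (r i)))
    (h0 : ∀ i, Γ i (α i) = Γ' i (α' i)) (h1 : ∀ i, Γ i (β i) = Γ' i (β' i))
    {F : (Fin n → ℂ) → ℂ} (hF : DifferentiableOn ℂ F {t | ∀ i, t i ∈ Metric.ball (c i) (r i)}) :
    ∫ s in univ.pi fun i => Icc (α i) (β i), pullback Γ F s =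
      ∫ s in univ.pi fun i => Icc (α' i) (β' i), pullback Γ' F s := by
  induction n with
  | zero =>
    have e1 : (univ.pi fun i => Icc (α i) (β i)) = univ := by
      ext s; simp
    have e2 : (univ.pi fun i => Icc (α' i) (β' i)) = univ := by
      ext s; simp
    rw [e1, e2]
    congr 1
    funext s
    simp only [pullback, Finset.univ_eq_empty, Finset.prod_empty]
    congr 2
    exact Subsingleton.elim _ _
  | succ n ih =>
    have hset : {t : Fin (n + 1) → ℂ | ∀ i, t i ∈ Metric.ball (c i) (r i)} =
        {t | t 0 ∈ Metric.ball (c 0) (r 0) ∧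
          ∀ i : Fin n, t i.succ ∈ Metric.ball (c i.succ) (r i.succ)} := by
      ext t; simp only [mem_ofPred_eq, Fin.forall_fin_succ]
    rw [hset] at hF
    have hFc := hF.continuousOn
    have hcons : ∀ z : Fin n → ℂ,
        Differentiable ℂ fun y : ℂ => (Fin.cons y z : Fin (n + 1) → ℂ) := by
      intro z
      refine differentiable_pi.mpr fun i => ?_
      refine Fin.cases ?_ (fun i => ?_) i
      · simp
      · simp
    have hcons' : ∀ y : ℂ,
        Differentiable ℂ fun z : Fin n → ℂ => (Fin.cons y z : Fin (n + 1) → ℂ) := by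
      intro y
      refine differentiable_pi.mpr fun i => ?_
      refine Fin.cases ?_ (fun i => ?_) i
      · simp
      · simpa using differentiable_apply i
    rw [setIntegral_pullback_succ, setIntegral_pullback_succ,
      integral_prod _ (integrable_pullback_cons (hΓ 0) (fun i => hΓ i.succ) hFc)]
    -- With the first variable frozen on its old path, the induction hypothesis moves all the
    -- others.
    have step1 : ∀ x ∈ Icc (α 0) (β 0),
        (∫ y in univ.pi fun i : Fin n => Icc (α i.succ) (β i.succ),
          F (Fin.cons (Γ 0 x) fun i => Γ i.succ (y i)) *
            (deriv (Γ 0) x * ∏ i : Fin n, deriv (Γ i.succ) (y i))) =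
        ∫ y in univ.pi fun i : Fin n => Icc (α' i.succ) (β' i.succ),
          F (Fin.cons (Γ 0 x) fun i => Γ' i.succ (y i)) *
            (deriv (Γ 0) x * ∏ i : Fin n, deriv (Γ' i.succ) (y i)) := by
      intro x hx
      have := ih (fun i => hΓ i.succ) (fun i => hΓ' i.succ) (fun i => h0 i.succ)
        (fun i => h1 i.succ) (F := fun z => F (Fin.cons (Γ 0 x) z))
        (hF.comp (hcons' _).differentiableOn fun z hz =>
          ⟨by simpa using (hΓ 0).mapsTo hx, by simpa using hz⟩)
      simp only [pullback] at this
      simp only [mul_left_comm _ (deriv (Γ 0) x)]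
      rw [integral_const_mul, integral_const_mul, this]
    -- The orders of integration are exchanged so that the first variable, now innermost, can be
    -- moved by the one-dimensional result.
    rw [setIntegral_congr_fun measurableSet_Icc step1,
      ← integral_prod _ (integrable_pullback_cons (hΓ 0) (fun i => hΓ' i.succ) hFc),
      integral_prod_symm _ (integrable_pullback_cons (hΓ 0) (fun i => hΓ' i.succ) hFc),
      integral_prod_symm _ (integrable_pullback_cons (hΓ' 0) (fun i => hΓ' i.succ) hFc)]
    refine setIntegral_congr_fun (MeasurableSet.univ_pi fun i => measurableSet_Icc) fun y hy => ?_
    have := (hΓ 0).integral_congr (hΓ' 0) (h0 0) (h1 0)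
      (f := fun z => F (Fin.cons z fun i => Γ' i.succ (y i)))
      (hF.comp (hcons _).differentiableOn fun z hz =>
        ⟨by simpa using hz, fun i => by simpa using (hΓ' i.succ).mapsTo (hy i (mem_univ i))⟩)
    simp only [← mul_assoc]
    rw [integral_mul_const, integral_mul_const, this]

end PathIndependence

/-! ### The contour of two half-lines -/

section Rays

variable (κ₁ κ₂ : ℂ)

theorem rayContour_eq (v : ℝ) :
    rayContour κ₁ κ₂ v = ((max (-v) 0 : ℝ) : ℂ) * κ₁ + ((max v 0 : ℝ) : ℂ) * κ₂ := by
  rw [rayContour]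
  split_ifs with h
  · rw [max_eq_left (by linarith), max_eq_right h]; simp
  · rw [max_eq_right (by linarith), max_eq_left (by linarith)]; simp

theorem continuous_rayContour : Continuous (rayContour κ₁ κ₂) := by
  rw [funext (rayContour_eq κ₁ κ₂)]
  fun_prop

theorem rayContour_mul {c : ℝ} (hc : 0 < c) (v : ℝ) :
    rayContour κ₁ κ₂ (c * v) = c * rayContour κ₁ κ₂ v := by
  rw [rayContour, rayContour]
  have : c * v ≤ 0 ↔ v ≤ 0 := by
    rw [← not_lt, ← not_lt, mul_pos_iff_of_pos_left hc]
  simp only [this]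
  split_ifs <;> push_cast <;> ring

theorem norm_rayContour_le (v : ℝ) : ‖rayContour κ₁ κ₂ v‖ ≤ max ‖κ₁‖ ‖κ₂‖ * |v| := by
  rw [rayContour]
  split_ifs
  · rw [norm_mul, Complex.norm_real, norm_neg, Real.norm_eq_abs, mul_comm]
    gcongr
    exact le_max_left _ _
  · rw [norm_mul, Complex.norm_real, Real.norm_eq_abs, mul_comm]
    gcongr
    exact le_max_right _ _

theorem hasDerivAt_rayContour_of_neg {v : ℝ} (hv : v < 0) :
    HasDerivAt (rayContour κ₁ κ₂) (-κ₁) v := by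
  have h1 : HasDerivAt (fun v : ℝ => ((-v : ℝ) : ℂ) * κ₁) (-κ₁) v := by
    have := ((hasDerivAt_id v).neg.ofReal_comp).mul_const κ₁
    simpa using this
  refine h1.congr_of_eventuallyEq ?_
  filter_upwards [Iio_mem_nhds hv] with u hu
  rw [rayContour, if_pos (mem_Iio.mp hu).le]

theorem hasDerivAt_rayContour_of_pos {v : ℝ} (hv : 0 < v) :
    HasDerivAt (rayContour κ₁ κ₂) κ₂ v := by
  have h1 : HasDerivAt (fun v : ℝ => ((v : ℝ) : ℂ) * κ₂) κ₂ v := by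
    have := ((hasDerivAt_id v).ofReal_comp).mul_const κ₂
    simpa using this
  refine h1.congr_of_eventuallyEq ?_
  filter_upwards [Ioi_mem_nhds hv] with u hu
  rw [rayContour, if_neg (not_le.mpr (mem_Ioi.mp hu))]

theorem differentiableAt_rayContour {v : ℝ} (hv : v ≠ 0) :
    DifferentiableAt ℝ (rayContour κ₁ κ₂) v := by
  rcases lt_or_gt_of_ne hv with h | h
  · exact (hasDerivAt_rayContour_of_neg κ₁ κ₂ h).differentiableAt
  · exact (hasDerivAt_rayContour_of_pos κ₁ κ₂ h).differentiableAt

theorem deriv_rayContour_mul {c : ℝ} (hc : 0 < c) (v : ℝ) :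
    deriv (rayContour κ₁ κ₂) (c * v) = deriv (rayContour κ₁ κ₂) v := by
  rcases lt_trichotomy v 0 with h | rfl | h
  · rw [(hasDerivAt_rayContour_of_neg κ₁ κ₂ h).deriv,
      (hasDerivAt_rayContour_of_neg κ₁ κ₂ (mul_neg_of_pos_of_neg hc h)).deriv]
  · rw [mul_zero]
  · rw [(hasDerivAt_rayContour_of_pos κ₁ κ₂ h).deriv,
      (hasDerivAt_rayContour_of_pos κ₁ κ₂ (mul_pos hc h)).deriv]

theorem exists_norm_deriv_rayContour_le :
    ∃ C, 0 ≤ C ∧ ∀ v, ‖deriv (rayContour κ₁ κ₂) v‖ ≤ C := by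
  -- The value of `deriv` at the possible corner `0` enters the maximum, so the bound needs no
  -- exception.
  refine ⟨max (max ‖κ₁‖ ‖κ₂‖) ‖deriv (rayContour κ₁ κ₂) 0‖, by positivity, fun v => ?_⟩
  rcases lt_trichotomy v 0 with h | rfl | h
  · rw [(hasDerivAt_rayContour_of_neg κ₁ κ₂ h).deriv, norm_neg]
    exact (le_max_left _ _).trans (le_max_left _ _)
  · exact le_max_right _ _
  · rw [(hasDerivAt_rayContour_of_pos κ₁ κ₂ h).deriv]
    exact (le_max_right _ _).trans (le_max_left _ _)

theorem exists_le_re_mul_rayContour_sq {a : ℂ} (h₁ : 0 < (a * κ₁ ^ 2).re)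
    (h₂ : 0 < (a * κ₂ ^ 2).re) :
    ∃ c > 0, ∀ v, c * v ^ 2 ≤ (a * rayContour κ₁ κ₂ v ^ 2).re := by
  refine ⟨min (a * κ₁ ^ 2).re (a * κ₂ ^ 2).re, lt_min h₁ h₂, fun v => ?_⟩
  rw [rayContour]
  split_ifs
  · have : a * (((-v : ℝ) : ℂ) * κ₁) ^ 2 = ((v ^ 2 : ℝ) : ℂ) * (a * κ₁ ^ 2) := by
      push_cast; ring
    rw [this, Complex.re_ofReal_mul, mul_comm]
    gcongr
    exact min_le_left _ _
  · have : a * ((v : ℂ) * κ₂) ^ 2 = ((v ^ 2 : ℝ) : ℂ) * (a * κ₂ ^ 2) := by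
      push_cast; ring
    rw [this, Complex.re_ofReal_mul, mul_comm]
    gcongr
    exact min_le_right _ _

end Rays

/-! ### Convergence of the Gaussian constants -/

theorem integrable_one_add_pow_mul_exp_neg_mul_sq {c : ℝ} (hc : 0 < c) (K : ℝ) (M : ℕ) :
    Integrable fun v : ℝ => (1 + K * |v|) ^ M * Real.exp (-c * v ^ 2) := by
  have h1 : ∀ j : ℕ, Integrable fun v : ℝ => |v| ^ j * Real.exp (-c * v ^ 2) := by
    intro j
    have := (integrable_rpow_mul_exp_neg_mul_sq hc (s := j)
      (by linarith [(Nat.cast_nonneg j : (0 : ℝ) ≤ j)])).norm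
    refine this.congr (Eventually.of_forall fun v => ?_)
    simp [Real.rpow_natCast]
  have h2 : (fun v : ℝ => (1 + K * |v|) ^ M * Real.exp (-c * v ^ 2)) = fun v =>
      ∑ j ∈ Finset.range (M + 1), (K ^ (M - j) * M.choose j) *
        (|v| ^ (M - j) * Real.exp (-c * v ^ 2)) := by
    funext v
    rw [add_pow, Finset.sum_mul]
    refine Finset.sum_congr rfl fun j _ => ?_
    rw [mul_pow]; ring
  rw [h2]
  exact integrable_finsetSum _ fun j _ => (h1 _).const_mul _

theorem one_add_norm_le_prod {n : ℕ} (v : Fin n → ℝ) : 1 + ‖v‖ ≤ ∏ i, (1 + |v i|) := by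
  have h1 : 1 ≤ ∏ i, (1 + |v i|) := Finset.one_le_prod fun i _ => by linarith [abs_nonneg (v i)]
  have h2 : ‖v‖ ≤ ∏ i, (1 + |v i|) - 1 := by
    refine (pi_norm_le_iff_of_nonneg (by linarith)).mpr fun i => ?_
    have : ∏ m ∈ {i}, (1 + |v m|) ≤ ∏ m, (1 + |v m|) :=
      Finset.prod_le_prod_of_subset_of_one_le (Finset.subset_univ _)
        (fun m _ => by linarith [abs_nonneg (v m)]) fun m _ _ => by linarith [abs_nonneg (v m)]
    rw [Finset.prod_singleton] at this
    rw [Real.norm_eq_abs]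
    linarith
  linarith

section Gauss

variable {n l : ℕ} {h : ℂ → ℂ} {A : ℂ} {k : ℕ} {xp xm ap am κp₁ κp₂ κm₁ κm₂ : ℂ}

theorem continuous_splitVandermonde (l : ℕ) (xp xm : ℂ) :
    Continuous (splitVandermonde (n := n) l xp xm) := by
  unfold splitVandermonde
  refine continuous_const.mul (continuous_finsetProd _ fun i _ => continuous_finsetProd _
    fun j _ => ?_)
  split_ifs <;> fun_prop

theorem aestronglyMeasurable_pullback {Γ : Fin n → ℝ → ℂ} {F : (Fin n → ℂ) → ℂ}
    {μ : Measure (Fin n → ℝ)}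
    (hF : AEStronglyMeasurable (fun s : Fin n → ℝ => F fun i => Γ i (s i)) μ) :
    AEStronglyMeasurable (pullback Γ F) μ := by
  refine hF.mul (Measurable.aestronglyMeasurable ?_)
  exact Finset.measurable_prod _ fun i _ => (measurable_deriv (Γ i)).comp (measurable_pi_apply i)

/-- The weight `1 + ‖v‖` is there for the error term of Laplace's method, which costs one extra
factor `‖v‖`. The majorant is a product of one-variable functions, polynomial times Gaussian. -/
theorem integrable_one_add_norm_mul_pullback_gaussIntegrand (hA : ∀ x, h x = A * x ^ k)
    (hp₁ : 0 < (ap / 2 * κp₁ ^ 2).re) (hp₂ : 0 < (ap / 2 * κp₂ ^ 2).re)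
    (hm₁ : 0 < (am / 2 * κm₁ ^ 2).re) (hm₂ : 0 < (am / 2 * κm₂ ^ 2).re) :
    AEStronglyMeasurable (pullback
      (splitContours (n := n) l (rayContour κp₁ κp₂) (rayContour κm₁ κm₂))
      (gaussIntegrand h xp xm ap am l)) volume ∧
    Integrable fun v => (1 + ‖v‖) * ‖pullback
      (splitContours (n := n) l (rayContour κp₁ κp₂) (rayContour κm₁ κm₂))
      (gaussIntegrand h xp xm ap am l) v‖ := by
  set Γ := splitContours (n := n) l (rayContour κp₁ κp₂) (rayContour κm₁ κm₂) with hΓ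
  obtain ⟨cp, hcp, hp⟩ := exists_le_re_mul_rayContour_sq κp₁ κp₂ hp₁ hp₂
  obtain ⟨cm, hcm, hm⟩ := exists_le_re_mul_rayContour_sq κm₁ κm₂ hm₁ hm₂
  obtain ⟨Dp, hDp, hdp⟩ := exists_norm_deriv_rayContour_le κp₁ κp₂
  obtain ⟨Dm, hDm, hdm⟩ := exists_norm_deriv_rayContour_le κm₁ κm₂
  obtain ⟨C, M, hC, hCM⟩ := norm_splitVandermonde_le (n := n) l xp xm
  have hc : 0 < min cp cm := lt_min hcp hcm
  set c := min cp cm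
  set D := max Dp Dm
  have hD : 0 ≤ D := hDp.trans (le_max_left _ _)
  set K := max 1 (max (max ‖κp₁‖ ‖κp₂‖) (max ‖κm₁‖ ‖κm₂‖))
  have hK : 1 ≤ K := le_max_left _ _
  have hΓc : ∀ i, Continuous (Γ i) := by
    intro i
    rw [hΓ, splitContours]
    split_ifs
    · exact continuous_rayContour _ _
    · exact continuous_rayContour _ _
  have hΓn : ∀ i v, ‖Γ i v‖ ≤ K * |v| := by
    intro i v
    rw [hΓ, splitContours]
    split_ifs
    · refine (norm_rayContour_le _ _ v).trans ?_
      gcongr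
      exact (le_max_left _ _).trans (le_max_right _ _)
    · refine (norm_rayContour_le _ _ v).trans ?_
      gcongr
      exact (le_max_right _ _).trans (le_max_right _ _)
  have hΓd : ∀ i v, ‖deriv (Γ i) v‖ ≤ D := by
    intro i v
    rw [hΓ, splitContours]
    split_ifs
    · exact (hdp v).trans (le_max_left _ _)
    · exact (hdm v).trans (le_max_right _ _)
  have hΓr : ∀ (i : Fin n) v, c * v ^ 2 ≤ ((if (i : ℕ) < l then ap else am) / 2 * Γ i v ^ 2).re := by
    intro i v
    rw [hΓ, splitContours]
    split_ifs
    · refine le_trans ?_ (hp v)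
      gcongr
      exact min_le_left _ _
    · refine le_trans ?_ (hm v)
      gcongr
      exact min_le_right _ _
  have hmeas : AEStronglyMeasurable (pullback Γ (gaussIntegrand h xp xm ap am l)) volume := by
    refine aestronglyMeasurable_pullback (Continuous.aestronglyMeasurable ?_)
    have hv : Continuous fun s : Fin n → ℝ => fun i => Γ i (s i) :=
      continuous_pi fun i => (hΓc i).comp (continuous_apply i)
    have hg : Continuous (gaussIntegrand (n := n) h xp xm ap am l) := by
      unfold gaussIntegrand
      refine (Complex.continuous_exp.comp ?_).mul ?_
      · fun_prop
      · simp only [hA]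
        exact continuous_const.mul ((continuous_splitVandermonde l xp xm).pow k)
    exact hg.comp hv
  refine ⟨hmeas, ?_⟩
  -- In the exponent, `M * k` comes from `h` of the split Vandermonde product and `1` from the
  -- weight.
  have hdom : Integrable fun v : Fin n → ℝ => (‖A‖ * C ^ k * D ^ n) *
      ∏ i, ((1 + K * |v i|) ^ (M * k + 1) * Real.exp (-c * v i ^ 2)) :=
    (Integrable.fintype_prod fun _ =>
      integrable_one_add_pow_mul_exp_neg_mul_sq hc K (M * k + 1)).const_mul _
  refine hdom.mono' ((continuous_const.add continuous_norm).aestronglyMeasurable.mul hmeas.norm)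
    (Eventually.of_forall fun v => ?_)
  rw [Real.norm_of_nonneg (by positivity), pullback, gaussIntegrand, norm_mul, norm_mul, norm_prod,
    Complex.norm_exp, hA, norm_mul, norm_pow, Finset.prod_mul_distrib, ← Real.exp_sum,
    Finset.prod_pow]
  have e1 : 1 + ‖v‖ ≤ ∏ i, (1 + K * |v i|) := by
    refine (one_add_norm_le_prod v).trans ?_
    refine Finset.prod_le_prod (fun i _ => by positivity) fun i _ => ?_
    nlinarith [abs_nonneg (v i)]
  have e2 : ‖splitVandermonde l xp xm fun i => Γ i (v i)‖ ≤ C * (∏ i, (1 + K * |v i|)) ^ M := by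
    refine (hCM _).trans ?_
    gcongr with i
    exact hΓn i (v i)
  have e3 : (-∑ i : Fin n, (if (i : ℕ) < l then ap else am) / 2 * Γ i (v i) ^ 2).re ≤
      ∑ i, -c * v i ^ 2 := by
    rw [Complex.neg_re, Complex.re_sum, ← Finset.sum_neg_distrib]
    refine Finset.sum_le_sum fun i _ => ?_
    linarith [hΓr i (v i)]
  have e4 : ∏ i, ‖deriv (Γ i) (v i)‖ ≤ D ^ n := by
    refine (Finset.prod_le_prod (fun i _ => norm_nonneg _) fun i _ => hΓd i (v i)).trans ?_
    simp
  have hP : 0 ≤ ∏ i, (1 + K * |v i|) := Finset.prod_nonneg fun i _ => by positivity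
  set P := ∏ i, (1 + K * |v i|)
  calc (1 + ‖v‖) * (Real.exp _ * (‖A‖ * ‖_‖ ^ k) * ∏ i, ‖deriv (Γ i) (v i)‖)
      ≤ P * (Real.exp (∑ i, -c * v i ^ 2) * (‖A‖ * (C * P ^ M) ^ k) * D ^ n) := by
        gcongr
    _ = ‖A‖ * C ^ k * D ^ n * (P ^ (M * k + 1) * Real.exp (∑ i, -c * v i ^ 2)) := by
        rw [mul_pow, ← pow_mul]; ring

theorem integrable_pullback_gaussIntegrand (hA : ∀ x, h x = A * x ^ k)
    (hp₁ : 0 < (ap / 2 * κp₁ ^ 2).re) (hp₂ : 0 < (ap / 2 * κp₂ ^ 2).re)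
    (hm₁ : 0 < (am / 2 * κm₁ ^ 2).re) (hm₂ : 0 < (am / 2 * κm₂ ^ 2).re) :
    Integrable (pullback
      (splitContours (n := n) l (rayContour κp₁ κp₂) (rayContour κm₁ κm₂))
      (gaussIntegrand h xp xm ap am l)) := by
  obtain ⟨hm, hi⟩ := integrable_one_add_norm_mul_pullback_gaussIntegrand (n := n) (l := l)
    (xp := xp) (xm := xm) hA hp₁ hp₂ hm₁ hm₂
  refine hi.mono' hm (Eventually.of_forall fun v => ?_)
  exact le_mul_of_one_le_left (norm_nonneg _) (by linarith [norm_nonneg v])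

end Gauss

/-! ### First-order estimates near the origin -/

section NearConst

variable {E : Type*} [NormedAddCommGroup E]

/-- On `K`, the function `f` differs from the constant `c` by `O(‖u‖)`. -/
def NearConst (K : Set E) (f : E → ℂ) (c : ℂ) : Prop :=
  ∃ C, 0 ≤ C ∧ ∀ u ∈ K, ‖f u - c‖ ≤ C * ‖u‖

theorem nearConst_const (K : Set E) (c : ℂ) : NearConst K (fun _ => c) c :=
  ⟨0, le_rfl, fun u _ => by simp⟩

theorem NearConst.mul {K : Set E} {R : ℝ} (hR : ∀ u ∈ K, ‖u‖ ≤ R) {f g : E → ℂ} {c d : ℂ}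
    (hf : NearConst K f c) (hg : NearConst K g d) : NearConst K (fun u => f u * g u) (c * d) := by
  obtain ⟨C, hC, hfC⟩ := hf
  obtain ⟨D, hD, hgD⟩ := hg
  refine ⟨C * (‖d‖ + D * |R|) + ‖c‖ * D, by positivity, fun u hu => ?_⟩
  have h1 : ‖g u‖ ≤ ‖d‖ + D * |R| := by
    calc ‖g u‖ = ‖d + (g u - d)‖ := by ring_nf
      _ ≤ ‖d‖ + ‖g u - d‖ := norm_add_le _ _
      _ ≤ ‖d‖ + D * |R| := by
        gcongr
        refine (hgD u hu).trans ?_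
        gcongr
        exact (hR u hu).trans (le_abs_self R)
  calc ‖f u * g u - c * d‖ = ‖(f u - c) * g u + c * (g u - d)‖ := by ring_nf
    _ ≤ ‖f u - c‖ * ‖g u‖ + ‖c‖ * ‖g u - d‖ := by
      refine (norm_add_le _ _).trans ?_
      rw [norm_mul, norm_mul]
    _ ≤ C * ‖u‖ * (‖d‖ + D * |R|) + ‖c‖ * (D * ‖u‖) := by
      gcongr
      · exact hfC u hu
      · exact hgD u hu
    _ = _ := by ring

theorem NearConst.prod {ι : Type*} {K : Set E} {R : ℝ} (hR : ∀ u ∈ K, ‖u‖ ≤ R) {f : ι → E → ℂ}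
    {c : ι → ℂ} (s : Finset ι) (hf : ∀ i ∈ s, NearConst K (f i) (c i)) :
    NearConst K (fun u => ∏ i ∈ s, f i u) (∏ i ∈ s, c i) := by
  classical
  induction s using Finset.induction_on with
  | empty => simpa using nearConst_const K 1
  | insert i s hi ih =>
    simp only [Finset.prod_insert hi]
    exact (hf i (Finset.mem_insert_self _ _)).mul hR
      (ih fun j hj => hf j (Finset.mem_insert_of_mem hj))

theorem NearConst.pow {K : Set E} {R : ℝ} (hR : ∀ u ∈ K, ‖u‖ ≤ R) {f : E → ℂ} {c : ℂ}
    (hf : NearConst K f c) (k : ℕ) : NearConst K (fun u => f u ^ k) (c ^ k) := by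
  have := NearConst.prod (ι := ℕ) hR (f := fun _ => f) (c := fun _ => c) (Finset.range k)
    fun _ _ => hf
  simpa using this

/-- Close to `0` differentiability gives the linear bound. At distance at least `ε` a bound `B` on
the compact set is at most `B / ε * ‖u‖`. -/
theorem nearConst_of_differentiableAt [NormedSpace ℂ E] {K : Set E} (hK : IsCompact K)
    {f : E → ℂ} (hc : ContinuousOn f K) (hd : DifferentiableAt ℂ f 0) : NearConst K f (f 0) := by
  obtain ⟨C, hC⟩ := hd.isBigO_sub.bound
  obtain ⟨ε, hε, hball⟩ := Metric.eventually_nhds_iff_ball.mp hC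
  obtain ⟨B, hB⟩ := hK.exists_bound_of_continuousOn (hc.sub (continuousOn_const (c := f 0)))
  refine ⟨max |C| (|B| / ε), by positivity, fun u hu => ?_⟩
  by_cases h : ‖u‖ < ε
  · have := hball u (by simpa using h)
    rw [sub_zero] at this
    refine this.trans ?_
    gcongr
    exact (le_abs_self C).trans (le_max_left _ _)
  · calc ‖f u - f 0‖ ≤ |B| := (hB u hu).trans (le_abs_self B)
      _ = |B| / ε * ε := by field_simp
      _ ≤ max |C| (|B| / ε) * ‖u‖ := by
        gcongr
        · exact le_max_right _ _
        · exact not_lt.mp h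

theorem NearConst.comp_apply {n : ℕ} {K : Set (Fin n → ℂ)} {S : Set ℂ} {f : ℂ → ℂ} {c : ℂ}
    (hf : NearConst S f c) (i : Fin n) (hKS : ∀ u ∈ K, u i ∈ S) :
    NearConst K (fun u => f (u i)) c := by
  obtain ⟨C, hC, hfC⟩ := hf
  refine ⟨C, hC, fun u hu => (hfC _ (hKS u hu)).trans ?_⟩
  gcongr
  exact norm_le_pi_norm u i

/-- The mean value inequality for `t z - z`, whose derivative vanishes at `0`. Applying it on the
smallest closed ball around `0` containing both points, rather than on the ball of radius `r`,
produces the factor `max ‖u‖ ‖u'‖`. -/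
theorem exists_norm_sub_sub_le {t : ℂ → ℂ} {V : Set ℂ} {r : ℝ} (hV : IsOpen V)
    (ht : DifferentiableOn ℂ t V) (hr : Metric.closedBall 0 r ⊆ V) (h0 : (0 : ℂ) ∈ V)
    (hd : deriv t 0 = 1) :
    ∃ C, 0 ≤ C ∧ ∀ u ∈ Metric.closedBall (0 : ℂ) r, ∀ u' ∈ Metric.closedBall (0 : ℂ) r,
      ‖t u - t u' - (u - u')‖ ≤ C * max ‖u‖ ‖u'‖ * ‖u - u'‖ := by
  have htd : DifferentiableOn ℂ (deriv t) V := ht.deriv hV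
  obtain ⟨C, hC, hCu⟩ := nearConst_of_differentiableAt (isCompact_closedBall (0 : ℂ) r)
    (htd.continuousOn.mono hr) (htd.differentiableAt (hV.mem_nhds h0))
  rw [hd] at hCu
  refine ⟨C, hC, fun u hu u' hu' => ?_⟩
  set m := max ‖u‖ ‖u'‖ with hm
  have hmr : Metric.closedBall (0 : ℂ) m ⊆ Metric.closedBall 0 r :=
    Metric.closedBall_subset_closedBall (max_le (by simpa using hu) (by simpa using hu'))
  have key := (convex_closedBall (0 : ℂ) m).norm_image_sub_le_of_norm_hasDerivWithin_le
    (f := fun z => t z - z) (f' := fun z => deriv t z - 1) (C := C * m) (x := u') (y := u)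
    (fun z hz => ((ht.differentiableAt (hV.mem_nhds (hr (hmr hz)))).hasDerivAt.sub
      (hasDerivAt_id z)).hasDerivWithinAt)
    (fun z hz => (hCu z (hmr hz)).trans (by gcongr; simpa using hz))
    (by simp [hm]) (by simp [hm])
  have e : t u - t u' - (u - u') = t u - u - (t u' - u') := by ring
  rw [e]
  exact key

end NearConst

/-! ### Comparison of the integrand with its leading term -/

section Factor

variable {n : ℕ} {p : ℂ → ℂ} {xp xm : ℂ} {ρp ρm rp rm : ℝ} {Vp Vm : Set ℂ} {tp tm : ℂ → ℂ}

/-- The closed polydisc with radius `rp` in the first `l` and `rm` in the other variables. -/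
def splitPolydisc (n l : ℕ) (rp rm : ℝ) : Set (Fin n → ℂ) :=
  univ.pi fun i => Metric.closedBall (0 : ℂ) (if (i : ℕ) < l then rp else rm)

/-- The map `tp` in the first `l` and `tm` in the other variables. -/
def splitMap (l : ℕ) (tp tm : ℂ → ℂ) (i : Fin n) : ℂ → ℂ := if (i : ℕ) < l then tp else tm

theorem isCompact_splitPolydisc (n l : ℕ) (rp rm : ℝ) : IsCompact (splitPolydisc n l rp rm) :=
  isCompact_univ_pi fun _ => isCompact_closedBall _ _

theorem norm_le_of_mem_splitPolydisc {l : ℕ} {u : Fin n → ℂ} (hu : u ∈ splitPolydisc n l rp rm) :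
    ‖u‖ ≤ max |rp| |rm| := by
  refine (pi_norm_le_iff_of_nonneg (by positivity)).mpr fun i => ?_
  have := hu i (mem_univ i)
  rw [mem_closedBall_zero_iff] at this
  split_ifs at this
  · exact this.trans ((le_abs_self _).trans (le_max_left _ _))
  · exact this.trans ((le_abs_self _).trans (le_max_right _ _))

/-- Within a block, `t (uᵢ) - t (uⱼ)` is `uᵢ - uⱼ` times a difference quotient close to `t' (0) =
1`. Across blocks the difference is close to `xp - xm ≠ 0`. -/
theorem exists_splitVandermonde_factor (hp : IsSaddleInverse p xp ρp Vp tp)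
    (hm : IsSaddleInverse p xm ρm Vm tm) (hrp : Metric.closedBall 0 rp ⊆ Vp)
    (hrm : Metric.closedBall 0 rm ⊆ Vm) (hne : xp ≠ xm) {l : ℕ} (hl : l ≤ n) :
    ∃ c : (Fin n → ℂ) → ℂ, NearConst (splitPolydisc n l rp rm) c 1 ∧
      ∀ u, vandermonde (fun i => splitMap l tp tm i (u i)) = splitVandermonde l xp xm u * c u := by
  have hsub : xp - xm ≠ 0 := sub_ne_zero.mpr hne
  have hR := fun (u : Fin n → ℂ) (hu : u ∈ splitPolydisc n l rp rm) =>
    norm_le_of_mem_splitPolydisc hu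
  have hlip : ∀ {x ρ r V t}, IsSaddleInverse p x ρ V t → Metric.closedBall 0 r ⊆ V →
      NearConst (Metric.closedBall 0 r) t x := by
    intro x ρ r V t ht hr
    have := nearConst_of_differentiableAt (isCompact_closedBall (0 : ℂ) r)
      (ht.holomorphic.continuousOn.mono hr)
      (ht.holomorphic.differentiableAt (ht.isOpen.mem_nhds ht.zero_mem))
    rwa [ht.map_zero] at this
  have hdd : ∀ {x ρ r V t}, IsSaddleInverse p x ρ V t → Metric.closedBall 0 r ⊆ V →
      ∀ i j : Fin n, (∀ u ∈ splitPolydisc n l rp rm, u i ∈ Metric.closedBall (0 : ℂ) r ∧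
        u j ∈ Metric.closedBall (0 : ℂ) r) →
      NearConst (splitPolydisc n l rp rm)
        (fun u => if u i = u j then 1 else (t (u i) - t (u j)) / (u i - u j)) 1 := by
    intro x ρ r V t ht hr i j hij
    obtain ⟨C, hC, hCu⟩ := exists_norm_sub_sub_le ht.isOpen ht.holomorphic hr ht.zero_mem
      ht.deriv_zero
    refine ⟨C, hC, fun u hu => ?_⟩
    dsimp only
    split_ifs with h
    · rw [sub_self, norm_zero]; positivity
    · have hd : u i - u j ≠ 0 := sub_ne_zero.mpr h
      have e : (t (u i) - t (u j)) / (u i - u j) - 1 =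
          (t (u i) - t (u j) - (u i - u j)) / (u i - u j) := by field_simp
      rw [e, norm_div, div_le_iff₀ (norm_pos_iff.mpr hd)]
      refine (hCu _ (hij u hu).1 _ (hij u hu).2).trans ?_
      gcongr
      exact max_le (norm_le_pi_norm u i) (norm_le_pi_norm u j)
  have hmem : ∀ (i : Fin n), ∀ u ∈ splitPolydisc n l rp rm,
      u i ∈ Metric.closedBall (0 : ℂ) (if (i : ℕ) < l then rp else rm) :=
    fun i u hu => hu i (mem_univ i)
  -- On the diagonal `u i = u j` both sides of the factorization vanish, so the value `1` chosen
  -- there is harmless and keeps the quotient near `1`.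
  refine ⟨fun u => ∏ i : Fin n, ∏ j ∈ Finset.Ioi i, if (i : ℕ) < l ↔ (j : ℕ) < l then
      (if u i = u j then 1 else
        (splitMap l tp tm i (u i) - splitMap l tp tm i (u j)) / (u i - u j))
      else (splitMap l tp tm i (u i) - splitMap l tp tm j (u j)) * (xp - xm)⁻¹, ?_, fun u => ?_⟩
  · have h1 : ∏ i : Fin n, ∏ j ∈ Finset.Ioi i, (1 : ℂ) = 1 := by simp
    suffices H : NearConst _ _ (∏ i : Fin n, ∏ j ∈ Finset.Ioi i, (1 : ℂ)) by rwa [h1] at H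
    refine NearConst.prod hR _ fun i _ => NearConst.prod hR _ fun j hj => ?_
    by_cases hij : (i : ℕ) < l ↔ (j : ℕ) < l
    · simp only [if_pos hij, splitMap]
      by_cases hi : (i : ℕ) < l
      · simp only [if_pos hi]
        refine hdd hp hrp i j fun u hu => ⟨?_, ?_⟩
        · simpa only [if_pos hi] using hmem i u hu
        · simpa only [if_pos (hij.mp hi)] using hmem j u hu
      · simp only [if_neg hi]
        refine hdd hm hrm i j fun u hu => ⟨?_, ?_⟩
        · simpa only [if_neg hi] using hmem i u hu
        · simpa only [if_neg fun hj => hi (hij.mpr hj)] using hmem j u hu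
    · have hij' : (i : ℕ) < (j : ℕ) := Fin.lt_def.mp (Finset.mem_Ioi.mp hj)
      -- As `i < j`, a pair from different blocks has `i` in the first one, so the limit is `xp -
      -- xm` and not its negative.
      have hi : (i : ℕ) < l := by by_contra; omega
      have hj : ¬ (j : ℕ) < l := fun hj => hij (by simp [hi, hj])
      simp only [if_neg hij, splitMap, if_pos hi, if_neg hj]
      have n1 := (hlip hp hrp).comp_apply (K := splitPolydisc n l rp rm) i
        fun u hu => by simpa only [if_pos hi] using hmem i u hu
      have n2 := (hlip hm hrm).comp_apply (K := splitPolydisc n l rp rm) j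
        fun u hu => by simpa only [if_neg hj] using hmem j u hu
      have n3 : NearConst (splitPolydisc n l rp rm) (fun u => tp (u i) - tm (u j)) (xp - xm) := by
        obtain ⟨C, hC, h1⟩ := n1
        obtain ⟨D, hD, h2⟩ := n2
        refine ⟨C + D, by positivity, fun u hu => ?_⟩
        calc ‖tp (u i) - tm (u j) - (xp - xm)‖ = ‖(tp (u i) - xp) - (tm (u j) - xm)‖ := by ring_nf
          _ ≤ C * ‖u‖ + D * ‖u‖ := (norm_sub_le _ _).trans (add_le_add (h1 u hu) (h2 u hu))
          _ = _ := by ring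
      have n4 := n3.mul hR (nearConst_const _ (xp - xm)⁻¹)
      rwa [mul_inv_cancel₀ hsub] at n4
  · rw [vandermonde, splitVandermonde, ← prod_cross_block hl, ← Finset.prod_mul_distrib,
      ← Finset.prod_mul_distrib]
    refine Finset.prod_congr rfl fun i _ => ?_
    rw [← Finset.prod_mul_distrib, ← Finset.prod_mul_distrib]
    refine Finset.prod_congr rfl fun j _ => ?_
    by_cases hij : (i : ℕ) < l ↔ (j : ℕ) < l
    · simp only [if_pos hij]
      have ht : splitMap l tp tm j = splitMap l tp tm i := by simp only [splitMap, hij]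
      rw [ht]
      split_ifs with h
      · rw [h]; simp
      · have hd : u i - u j ≠ 0 := sub_ne_zero.mpr h
        field_simp
    · simp only [if_neg hij]
      field_simp

/-- The error is measured against `h` of the split Vandermonde product, which vanishes at the saddle
point. This keeps it homogeneous, so that rescaling leaves it smaller than the main term by `√N`. -/
theorem exists_norm_integrand_sub_le (hp : IsSaddleInverse p xp ρp Vp tp)
    (hm : IsSaddleInverse p xm ρm Vm tm) (hrp : Metric.closedBall 0 rp ⊆ Vp)
    (hrm : Metric.closedBall 0 rm ⊆ Vm) (hne : xp ≠ xm) {l : ℕ} (hl : l ≤ n)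
    {T : Set ℂ} (hT : IsOpen T) (hpT : Metric.ball xp ρp ⊆ T) (hmT : Metric.ball xm ρm ⊆ T)
    {q : (Fin n → ℂ) → ℂ} (hq : DifferentiableOn ℂ q {t | ∀ i, t i ∈ T})
    {h : ℂ → ℂ} {A : ℂ} {k : ℕ} (hA : ∀ x, h x = A * x ^ k) :
    ∃ C, 0 ≤ C ∧ ∀ u ∈ splitPolydisc n l rp rm,
      ‖h (vandermonde fun i => splitMap l tp tm i (u i)) *
          q (fun i => splitMap l tp tm i (u i)) * ∏ i, deriv (splitMap l tp tm i) (u i) -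
        q (saddlePoint l xp xm) * h (splitVandermonde l xp xm u)‖ ≤
        C * ‖u‖ * ‖h (splitVandermonde l xp xm u)‖ := by
  have hR := fun (u : Fin n → ℂ) (hu : u ∈ splitPolydisc n l rp rm) =>
    norm_le_of_mem_splitPolydisc hu
  have hS : ∀ i : Fin n, ∃ V, IsOpen V ∧ (0 : ℂ) ∈ V ∧
      DifferentiableOn ℂ (splitMap l tp tm i) V ∧ MapsTo (splitMap l tp tm i) V T ∧
      splitMap l tp tm i 0 = saddlePoint l xp xm i ∧ deriv (splitMap l tp tm i) 0 = 1 ∧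
      Metric.closedBall (0 : ℂ) (if (i : ℕ) < l then rp else rm) ⊆ V := by
    intro i
    simp only [splitMap, saddlePoint]
    split_ifs
    · exact ⟨Vp, hp.isOpen, hp.zero_mem, hp.holomorphic, fun u hu => hpT (hp.mapsTo hu),
        hp.map_zero, hp.deriv_zero, hrp⟩
    · exact ⟨Vm, hm.isOpen, hm.zero_mem, hm.holomorphic, fun u hu => hmT (hm.mapsTo hu),
        hm.map_zero, hm.deriv_zero, hrm⟩
  choose V hVo hV0 hVd hVm hVs hV1 hVr using hS
  obtain ⟨c, hc, hcv⟩ := exists_splitVandermonde_factor (n := n) hp hm hrp hrm hne hl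
  have hK := isCompact_splitPolydisc n l rp rm
  have hTo : IsOpen {t : Fin n → ℂ | ∀ i, t i ∈ T} := by
    have : {t : Fin n → ℂ | ∀ i, t i ∈ T} = univ.pi fun _ => T := by ext; simp
    rw [this]
    exact isOpen_set_pi finite_univ fun _ _ => hT
  have nq : NearConst (splitPolydisc n l rp rm) (fun u => q fun i => splitMap l tp tm i (u i))
      (q (saddlePoint l xp xm)) := by
    have e : q (saddlePoint l xp xm) =
        (fun u : Fin n → ℂ => q fun i => splitMap l tp tm i (u i)) 0 := by
      congr 1
      funext i
      exact (hVs i).symm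
    rw [e]
    have hmap : ∀ u : Fin n → ℂ, (∀ i, u i ∈ V i) →
        DifferentiableAt ℂ (fun u : Fin n → ℂ => q fun i => splitMap l tp tm i (u i)) u := by
      intro u hu
      refine DifferentiableAt.comp (g := q) u
        (hq.differentiableAt (hTo.mem_nhds fun i => hVm i (hu i))) ?_
      refine differentiableAt_pi.mpr fun i => ?_
      exact ((hVd i).differentiableAt ((hVo i).mem_nhds (hu i))).comp u (differentiableAt_apply i u)
    exact nearConst_of_differentiableAt hK
      (fun u hu => (hmap u fun i => hVr i (hu i (mem_univ i))).continuousAt.continuousWithinAt)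
      (hmap 0 hV0)
  have nd : NearConst (splitPolydisc n l rp rm)
      (fun u => ∏ i, deriv (splitMap l tp tm i) (u i)) 1 := by
    have h1 : ∏ i : Fin n, (1 : ℂ) = 1 := by simp
    rw [← h1]
    refine NearConst.prod hR _ fun i _ => ?_
    have htd : DifferentiableOn ℂ (deriv (splitMap l tp tm i)) (V i) := (hVd i).deriv (hVo i)
    have := nearConst_of_differentiableAt
      (isCompact_closedBall (0 : ℂ) (if (i : ℕ) < l then rp else rm))
      (htd.continuousOn.mono (hVr i)) (htd.differentiableAt ((hVo i).mem_nhds (hV0 i)))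
    rw [hV1 i] at this
    exact this.comp_apply i fun u hu => hu i (mem_univ i)
  have nall := ((hc.pow hR k).mul hR nq).mul hR nd
  rw [one_pow, one_mul, mul_one] at nall
  obtain ⟨C, hC, hCu⟩ := nall
  refine ⟨C, hC, fun u hu => ?_⟩
  rw [hcv, hA, hA]
  calc ‖_‖ = ‖(c u ^ k * (q fun i => splitMap l tp tm i (u i)) *
        ∏ i, deriv (splitMap l tp tm i) (u i) - q (saddlePoint l xp xm)) *
        (A * splitVandermonde l xp xm u ^ k)‖ := by
        congr 1; ring
    _ ≤ _ := by
        rw [norm_mul]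
        gcongr
        exact hCu u hu

end Factor

/-! ### Segments transported by the inverse coordinate -/

theorem integrableOn_deriv_rayContour (κ₁ κ₂ : ℂ) (α β : ℝ) :
    IntegrableOn (deriv (rayContour κ₁ κ₂)) (Icc α β) := by
  obtain ⟨C, -, hC⟩ := exists_norm_deriv_rayContour_le κ₁ κ₂
  exact Integrable.of_bound (measurable_deriv _).aestronglyMeasurable C (Eventually.of_forall hC)

section LocalPath

variable {p : ℂ → ℂ} {x : ℂ} {ρ : ℝ} {V : Set ℂ} {t : ℂ → ℂ} {κ₁ κ₂ : ℂ}

theorem rayContour_mem_closedBall {v : ℝ} (hv : |v| ≤ 1) :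
    rayContour κ₁ κ₂ v ∈ Metric.closedBall (0 : ℂ) (max ‖κ₁‖ ‖κ₂‖) := by
  rw [mem_closedBall_zero_iff]
  refine (norm_rayContour_le κ₁ κ₂ v).trans ?_
  exact mul_le_of_le_one_right (by positivity) hv

theorem IsSaddleInverse.deriv_comp_rayContour (ht : IsSaddleInverse p x ρ V t)
    (hV : Metric.closedBall 0 (max ‖κ₁‖ ‖κ₂‖) ⊆ V) {v : ℝ} (hv : |v| ≤ 1) (hv0 : v ≠ 0) :
    HasDerivAt (fun s => t (rayContour κ₁ κ₂ s))
      (deriv t (rayContour κ₁ κ₂ v) * deriv (rayContour κ₁ κ₂) v) v := by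
  have h1 : HasDerivAt t (deriv t (rayContour κ₁ κ₂ v)) (rayContour κ₁ κ₂ v) :=
    (ht.holomorphic.differentiableAt
      (ht.isOpen.mem_nhds (hV (rayContour_mem_closedBall hv)))).hasDerivAt
  refine (h1.scomp v (differentiableAt_rayContour κ₁ κ₂ hv0).hasDerivAt).congr_deriv ?_
  rw [smul_eq_mul, mul_comm]

theorem IsSaddleInverse.isPathIn (ht : IsSaddleInverse p x ρ V t)
    (hV : Metric.closedBall 0 (max ‖κ₁‖ ‖κ₂‖) ⊆ V) :
    IsPathIn (fun s => t (rayContour κ₁ κ₂ s)) (-1) 1 (Metric.ball x ρ) := by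
  have hmaps : MapsTo (rayContour κ₁ κ₂) (Icc (-1) 1) V := fun v hv =>
    hV (rayContour_mem_closedBall (abs_le.mpr hv))
  have hray := (continuous_rayContour κ₁ κ₂).continuousOn (s := Icc (-1) 1)
  refine ⟨by norm_num, ht.holomorphic.continuousOn.comp hray hmaps,
    ht.mapsTo.comp hmaps, ⟨{0}, countable_singleton 0, fun s hs => ?_⟩, ?_⟩
  · exact (ht.deriv_comp_rayContour hV (abs_le.mpr (Ioo_subset_Icc_self hs.1))
      (by simpa using hs.2)).differentiableAt
  · have h1 : IntegrableOn (fun v => deriv t (rayContour κ₁ κ₂ v) * deriv (rayContour κ₁ κ₂) v)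
        (Icc (-1) 1) :=
      (integrableOn_deriv_rayContour κ₁ κ₂ _ _).continuousOn_mul
        (((ht.holomorphic.deriv ht.isOpen).continuousOn).comp hray hmaps) isCompact_Icc
    refine h1.congr_fun_ae ?_
    rw [EventuallyEq, ae_restrict_iff' measurableSet_Icc]
    filter_upwards [Measure.ae_ne volume (0 : ℝ)] with v hv0 hv
    exact (ht.deriv_comp_rayContour hV (abs_le.mpr hv) hv0).deriv.symm

end LocalPath

theorem ae_forall_ne_zero (n : ℕ) : ∀ᵐ v : Fin n → ℝ, ∀ i, v i ≠ 0 := by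
  refine ae_all_iff.mpr fun i => ?_
  have := (Measure.quasiMeasurePreserving_eval (fun _ : Fin n => (volume : Measure ℝ)) i).ae
    (Measure.ae_ne volume (0 : ℝ))
  exact this

/-! ### Laplace's method near a saddle point -/

section Laplace

variable {n l k : ℕ} {p h : ℂ → ℂ} {q : (Fin n → ℂ) → ℂ} {T : Set ℂ} {A : ℂ}
  {xp xm κp₁ κp₂ κm₁ κm₂ : ℂ} {ρp ρm : ℝ} {Vp Vm : Set ℂ} {tp tm : ℂ → ℂ}

/-- The path `t ∘ rayContour` in every variable, for the local inverses `t = tp` or `t = tm`. -/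
noncomputable def localContours (n l : ℕ) (tp tm : ℂ → ℂ) (κp₁ κp₂ κm₁ κm₂ : ℂ) (i : Fin n) (v : ℝ) : ℂ :=
  splitMap l tp tm i (splitContours l (rayContour κp₁ κp₂) (rayContour κm₁ κm₂) i v)

/-- The integrand `exp(-N ∑ᵢ (p(zᵢ) - p(xᵢ))) h(Δ(z)) q(z)`, normalized at the point `x`. -/
noncomputable def normalizedIntegrand (p h : ℂ → ℂ) (q : (Fin n → ℂ) → ℂ) (x : Fin n → ℂ) (N : ℝ)
    (z : Fin n → ℂ) : ℂ :=
  Complex.exp (-(N : ℂ) * ∑ i, (p (z i) - p (x i))) * h (vandermonde z) * q z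

theorem differentiableOn_normalizedIntegrand (hp : DifferentiableOn ℂ p T)
    (hh : Differentiable ℂ h) (hq : DifferentiableOn ℂ q {t | ∀ i, t i ∈ T})
    (x : Fin n → ℂ) (N : ℝ) :
    DifferentiableOn ℂ (normalizedIntegrand p h q x N) {t | ∀ i, t i ∈ T} := by
  have h1 : ∀ i : Fin n, DifferentiableOn ℂ (fun z : Fin n → ℂ => p (z i)) {t | ∀ i, t i ∈ T} :=
    fun i => hp.comp (differentiable_apply i).differentiableOn fun z hz => hz i
  have h2 : Differentiable ℂ (vandermonde (n := n)) := by
    unfold vandermonde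
    fun_prop
  unfold normalizedIntegrand
  refine ((DifferentiableOn.cexp ?_).mul (hh.comp h2).differentiableOn).mul hq
  refine (DifferentiableOn.fun_sum fun i _ => (h1 i).sub_const _).const_mul _

theorem IsSaddleInverse.isPathIn_localContours (hp : IsSaddleInverse p xp ρp Vp tp)
    (hm : IsSaddleInverse p xm ρm Vm tm)
    (hrp : Metric.closedBall 0 (max ‖κp₁‖ ‖κp₂‖) ⊆ Vp)
    (hrm : Metric.closedBall 0 (max ‖κm₁‖ ‖κm₂‖) ⊆ Vm) (i : Fin n) :
    IsPathIn (localContours n l tp tm κp₁ κp₂ κm₁ κm₂ i) (-1) 1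
      (Metric.ball (saddlePoint l xp xm i) (if (i : ℕ) < l then ρp else ρm)) := by
  by_cases hi : (i : ℕ) < l
  · have e : localContours n l tp tm κp₁ κp₂ κm₁ κm₂ i = fun s => tp (rayContour κp₁ κp₂ s) := by
      funext v
      simp only [localContours, splitMap, splitContours, if_pos hi]
    rw [e, saddlePoint, if_pos hi, if_pos hi]
    exact hp.isPathIn hrp
  · have e : localContours n l tp tm κp₁ κp₂ κm₁ κm₂ i = fun s => tm (rayContour κm₁ κm₂ s) := by
      funext v
      simp only [localContours, splitMap, splitContours, if_neg hi]
    rw [e, saddlePoint, if_neg hi, if_neg hi]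
    exact hm.isPathIn hrm

theorem splitContours_mul (l : ℕ) {c : ℝ} (hc : 0 < c) (i : Fin n) (v : ℝ) :
    splitContours l (rayContour κp₁ κp₂) (rayContour κm₁ κm₂) i (c * v) =
      c * splitContours l (rayContour κp₁ κp₂) (rayContour κm₁ κm₂) i v ∧
    deriv (splitContours l (rayContour κp₁ κp₂) (rayContour κm₁ κm₂) i) (c * v) =
      deriv (splitContours l (rayContour κp₁ κp₂) (rayContour κm₁ κm₂) i) v := by
  rw [splitContours]
  split_ifs
  · exact ⟨rayContour_mul _ _ hc v, deriv_rayContour_mul _ _ hc v⟩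
  · exact ⟨rayContour_mul _ _ hc v, deriv_rayContour_mul _ _ hc v⟩

theorem norm_splitContours_le (l : ℕ) (i : Fin n) (v : ℝ) :
    ‖splitContours l (rayContour κp₁ κp₂) (rayContour κm₁ κm₂) i v‖ ≤
      (if (i : ℕ) < l then max ‖κp₁‖ ‖κp₂‖ else max ‖κm₁‖ ‖κm₂‖) * |v| := by
  rw [splitContours]
  split_ifs
  · exact norm_rayContour_le _ _ v
  · exact norm_rayContour_le _ _ v

theorem pullback_localContours (hp : IsSaddleInverse p xp ρp Vp tp)
    (hm : IsSaddleInverse p xm ρm Vm tm)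
    (hrp : Metric.closedBall 0 (max ‖κp₁‖ ‖κp₂‖) ⊆ Vp)
    (hrm : Metric.closedBall 0 (max ‖κm₁‖ ‖κm₂‖) ⊆ Vm) (N : ℝ) {v : Fin n → ℝ} {u : Fin n → ℂ}
    (hv : ∀ i, |v i| ≤ 1) (hv0 : ∀ i, v i ≠ 0)
    (hu : ∀ i, u i = splitContours l (rayContour κp₁ κp₂) (rayContour κm₁ κm₂) i (v i)) :
    pullback (localContours n l tp tm κp₁ κp₂ κm₁ κm₂)
      (normalizedIntegrand p h q (saddlePoint l xp xm) N) v =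
    Complex.exp (-∑ i : Fin n, (if (i : ℕ) < l then deriv (deriv p) xp else deriv (deriv p) xm) / 2 *
        (N * u i ^ 2)) *
      (h (vandermonde fun i => splitMap l tp tm i (u i)) *
          q (fun i => splitMap l tp tm i (u i)) * ∏ i, deriv (splitMap l tp tm i) (u i)) *
      ∏ i, deriv (splitContours l (rayContour κp₁ κp₂) (rayContour κm₁ κm₂) i) (v i) := by
  have hΛ : ∀ i, localContours n l tp tm κp₁ κp₂ κm₁ κm₂ i (v i) = splitMap l tp tm i (u i) := by
    intro i
    rw [localContours, hu]
  have hd : ∀ i, deriv (localContours n l tp tm κp₁ κp₂ κm₁ κm₂ i) (v i) =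
      deriv (splitMap l tp tm i) (u i) *
        deriv (splitContours l (rayContour κp₁ κp₂) (rayContour κm₁ κm₂) i) (v i) := by
    intro i
    rw [hu]
    by_cases hi : (i : ℕ) < l
    · have e : localContours n l tp tm κp₁ κp₂ κm₁ κm₂ i =
          fun s => tp (rayContour κp₁ κp₂ s) := by
        funext v
        simp only [localContours, splitMap, splitContours, if_pos hi]
      rw [e, splitMap, splitContours, if_pos hi, if_pos hi]
      exact (hp.deriv_comp_rayContour hrp (hv i) (hv0 i)).deriv
    · have e : localContours n l tp tm κp₁ κp₂ κm₁ κm₂ i =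
          fun s => tm (rayContour κm₁ κm₂ s) := by
        funext v
        simp only [localContours, splitMap, splitContours, if_neg hi]
      rw [e, splitMap, splitContours, if_neg hi, if_neg hi]
      exact (hm.deriv_comp_rayContour hrm (hv i) (hv0 i)).deriv
  have hpu : ∀ i, p (splitMap l tp tm i (u i)) - p (saddlePoint l xp xm i) =
      (if (i : ℕ) < l then deriv (deriv p) xp else deriv (deriv p) xm) / 2 * u i ^ 2 := by
    intro i
    rw [hu, splitMap, splitContours, saddlePoint]
    split_ifs
    · exact hp.apply_sub _ (hrp (rayContour_mem_closedBall (hv i)))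
    · exact hm.apply_sub _ (hrm (rayContour_mem_closedBall (hv i)))
  rw [pullback, normalizedIntegrand]
  simp only [hΛ, hd, hpu]
  rw [Finset.prod_mul_distrib]
  have e : -(N : ℂ) * ∑ i : Fin n, (if (i : ℕ) < l then deriv (deriv p) xp else
      deriv (deriv p) xm) / 2 * u i ^ 2 =
      -∑ i : Fin n, (if (i : ℕ) < l then deriv (deriv p) xp else deriv (deriv p) xm) / 2 *
        (N * u i ^ 2) := by
    rw [neg_mul, Finset.mul_sum]
    congr 1
    exact Finset.sum_congr rfl fun i _ => by ring
  rw [e]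
  ring

/-- Laplace's method for the part of the integral close to a saddle point. -/
theorem exists_norm_localIntegral_sub_le (hp : IsSaddleInverse p xp ρp Vp tp)
    (hm : IsSaddleInverse p xm ρm Vm tm)
    (hrp : Metric.closedBall 0 (max ‖κp₁‖ ‖κp₂‖) ⊆ Vp)
    (hrm : Metric.closedBall 0 (max ‖κm₁‖ ‖κm₂‖) ⊆ Vm) (hne : xp ≠ xm) (hl : l ≤ n)
    (hT : IsOpen T) (hpT : Metric.ball xp ρp ⊆ T) (hmT : Metric.ball xm ρm ⊆ T)
    (hpd : DifferentiableOn ℂ p T) (hh : Differentiable ℂ h)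
    (hq : DifferentiableOn ℂ q {t | ∀ i, t i ∈ T}) (hA : ∀ x, h x = A * x ^ k)
    (hp₁ : 0 < (deriv (deriv p) xp / 2 * κp₁ ^ 2).re)
    (hp₂ : 0 < (deriv (deriv p) xp / 2 * κp₂ ^ 2).re)
    (hm₁ : 0 < (deriv (deriv p) xm / 2 * κm₁ ^ 2).re)
    (hm₂ : 0 < (deriv (deriv p) xm / 2 * κm₂ ^ 2).re) :
    ∃ C, ∀ N : ℝ, 0 < N →
      ‖((√N ^ ((l.choose 2 + (n - l).choose 2) * k + n) : ℝ) : ℂ) *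
        (∫ v in univ.pi fun _ : Fin n => Icc (-1 : ℝ) 1,
          pullback (localContours n l tp tm κp₁ κp₂ κm₁ κm₂)
            (normalizedIntegrand p h q (saddlePoint l xp xm) N) v) -
        q (saddlePoint l xp xm) *
          contourIntegral (splitContours l (rayContour κp₁ κp₂) (rayContour κm₁ κm₂))
            (gaussIntegrand (n := n) h xp xm (deriv (deriv p) xp) (deriv (deriv p) xm) l)‖ ≤
      C * (√N)⁻¹ := by
  obtain ⟨hEm, hEi⟩ := integrable_one_add_norm_mul_pullback_gaussIntegrand (n := n) (l := l)
    (xp := xp) (xm := xm) hA hp₁ hp₂ hm₁ hm₂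
  obtain ⟨C, hC, hCu⟩ := exists_norm_integrand_sub_le hp hm hrp hrm hne hl hT hpT hmT hq hA
  set Γ := splitContours (n := n) l (rayContour κp₁ κp₂) (rayContour κm₁ κm₂) with hΓ
  set E := pullback Γ (gaussIntegrand h xp xm (deriv (deriv p) xp) (deriv (deriv p) xm) l) with hE
  set P := l.choose 2 + (n - l).choose 2 with hP
  set Q := q (saddlePoint l xp xm) with hQ
  set κ := max (max ‖κp₁‖ ‖κp₂‖) (max ‖κm₁‖ ‖κm₂‖) with hκ
  have hEint : Integrable E := integrable_pullback_gaussIntegrand hA hp₁ hp₂ hm₁ hm₂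
  -- The integral of this function is the constant in front of `1 / √N`.
  have hvE : Integrable fun v => ‖v‖ * ‖E v‖ := by
    refine hEi.mono' (continuous_norm.aestronglyMeasurable.mul hEm.norm)
      (Eventually.of_forall fun v => ?_)
    rw [Real.norm_of_nonneg (by positivity)]
    nlinarith [norm_nonneg v, norm_nonneg (E v)]
  refine ⟨(C * κ + ‖Q‖) * ∫ v, ‖v‖ * ‖E v‖, fun N hN => ?_⟩
  have hS : 0 < √N := Real.sqrt_pos.mpr hN
  set S := √N with hSdef
  have hSS : S ^ 2 = N := Real.sq_sqrt hN.le
  set box : Set (Fin n → ℝ) := univ.pi fun _ => Icc (-1 : ℝ) 1 with hbox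
  have hboxm : MeasurableSet box := MeasurableSet.univ_pi fun _ => measurableSet_Icc
  set f := pullback (localContours n l tp tm κp₁ κp₂ κm₁ κm₂)
    (normalizedIntegrand p h q (saddlePoint l xp xm) N) with hf
  have hfint : IntegrableOn f box := by
    refine integrable_pullback_pi (fun i => hp.isPathIn_localContours hm hrp hrm i)
      ((differentiableOn_normalizedIntegrand hpd hh hq _ N).continuousOn.mono fun t ht i => ?_)
    have := ht i
    rw [saddlePoint] at this
    split_ifs at this
    · exact hpT this
    · exact hmT this
  have hgint : Integrable (box.indicator f) := (integrable_indicator_iff hboxm).mpr hfint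
  have hΦint : Integrable fun v => ((S ^ (P * k) : ℝ) : ℂ) * box.indicator f (S⁻¹ • v) :=
    (hgint.comp_smul (inv_ne_zero hS.ne')).const_mul _
  have hscale : ((S ^ (P * k + n) : ℝ) : ℂ) * (∫ v in box, f v) =
      -- Extension by zero makes the substitution `v ↦ v / √N` a scaling of the whole space, with
      -- Jacobian `S ^ n`.
      ∫ v, ((S ^ (P * k) : ℝ) : ℂ) * box.indicator f (S⁻¹ • v) := by
    rw [integral_const_mul, Measure.integral_comp_smul, integral_indicator hboxm,
      Module.finrank_fin_fun, inv_pow, inv_inv, abs_of_pos (by positivity), pow_add]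
    rw [Complex.real_smul]
    push_cast
    ring
  -- One bound serves both cases: `C * κ` covers the error inside the rescaled box, `‖Q‖` the
  -- Gaussian tail missing outside it.
  have hpt : ∀ᵐ v : Fin n → ℝ, ‖((S ^ (P * k) : ℝ) : ℂ) * box.indicator f (S⁻¹ • v) - Q * E v‖ ≤
      (C * κ + ‖Q‖) * S⁻¹ * (‖v‖ * ‖E v‖) := by
    filter_upwards [ae_forall_ne_zero n] with v hv0
    by_cases hv : S⁻¹ • v ∈ box
    · rw [indicator_of_mem hv]
      have hv1 : ∀ i, |S⁻¹ * v i| ≤ 1 := fun i => abs_le.mpr (hv i (mem_univ i))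
      have hSi : 0 < S⁻¹ := inv_pos.mpr hS
      set w : Fin n → ℂ := fun i => Γ i (v i) with hw
      set u : Fin n → ℂ := fun i => ((S⁻¹ : ℝ) : ℂ) * w i with hu
      have hu' : ∀ i, u i = Γ i ((S⁻¹ • v) i) := fun i =>
        (splitContours_mul l hSi i (v i)).1.symm
      have hupoly : u ∈ splitPolydisc n l (max ‖κp₁‖ ‖κp₂‖) (max ‖κm₁‖ ‖κm₂‖) := by
        intro i _
        rw [mem_closedBall_zero_iff, hu']
        refine (norm_splitContours_le l i _).trans (mul_le_of_le_one_right ?_ (hv1 i))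
        split_ifs <;> positivity
      have hunorm : ‖u‖ ≤ κ * (S⁻¹ * ‖v‖) := by
        refine (pi_norm_le_iff_of_nonneg (by positivity)).mpr fun i => ?_
        rw [hu']
        refine (norm_splitContours_le l i _).trans ?_
        gcongr
        · split_ifs
          · exact le_max_left _ _
          · exact le_max_right _ _
        · rw [Pi.smul_apply, smul_eq_mul, abs_mul, abs_of_pos hSi]
          gcongr
          exact norm_le_pi_norm v i
      have hfv := pullback_localContours (h := h) (q := q) (l := l) hp hm hrp hrm N
        (v := S⁻¹ • v) (u := u) hv1
        (fun i => mul_ne_zero hSi.ne' (hv0 i)) hu'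
      have hder : ∏ i, deriv (Γ i) ((S⁻¹ • v) i) = ∏ i, deriv (Γ i) (v i) :=
        Finset.prod_congr rfl fun i _ => (splitContours_mul l hSi i (v i)).2
      have hNu : ∀ i, (N : ℂ) * u i ^ 2 = w i ^ 2 := by
        intro i
        simp only [hu]
        rw [← hSS]
        have : (S : ℂ) ≠ 0 := by exact_mod_cast hS.ne'
        push_cast
        field_simp
      simp only [hNu] at hfv
      rw [← hΓ, hder] at hfv
      have hsplit : h (splitVandermonde l xp xm w) =
          ((S ^ (P * k) : ℝ) : ℂ) * h (splitVandermonde l xp xm u) := by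
        rw [hu, splitVandermonde_smul hl, hA, hA, mul_pow, ← pow_mul]
        have : (S : ℂ) ≠ 0 := by exact_mod_cast hS.ne'
        push_cast
        rw [← hP, inv_pow]
        field_simp
      have hEv : E v = Complex.exp (-∑ i : Fin n,
          (if (i : ℕ) < l then deriv (deriv p) xp else deriv (deriv p) xm) / 2 * w i ^ 2) *
          (((S ^ (P * k) : ℝ) : ℂ) * h (splitVandermonde l xp xm u)) *
          ∏ i, deriv (Γ i) (v i) := by
        rw [hE, pullback, gaussIntegrand, ← hw, hsplit]
      set ex := Complex.exp (-∑ i : Fin n,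
          (if (i : ℕ) < l then deriv (deriv p) xp else deriv (deriv p) xm) / 2 * w i ^ 2)
      set D := ∏ i, deriv (Γ i) (v i)
      rw [hf, hfv, hEv]
      have e1 : ∀ Ψ H : ℂ, ((S ^ (P * k) : ℝ) : ℂ) * (ex * Ψ * D) -
          Q * (ex * (((S ^ (P * k) : ℝ) : ℂ) * H) * D) =
          ex * ((S ^ (P * k) : ℝ) : ℂ) * D * (Ψ - Q * H) := fun Ψ H => by ring
      rw [e1, norm_mul]
      calc _ ≤ ‖ex * ((S ^ (P * k) : ℝ) : ℂ) * D‖ *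
            (C * ‖u‖ * ‖h (splitVandermonde l xp xm u)‖) := by
            gcongr
            exact hCu u hupoly
        _ = C * ‖u‖ * ‖ex * (((S ^ (P * k) : ℝ) : ℂ) * h (splitVandermonde l xp xm u)) * D‖ := by
            simp only [norm_mul]; ring
        _ ≤ C * (κ * (S⁻¹ * ‖v‖)) *
            ‖ex * (((S ^ (P * k) : ℝ) : ℂ) * h (splitVandermonde l xp xm u)) * D‖ := by
            gcongr
        _ ≤ (C * κ + ‖Q‖) * S⁻¹ * (‖v‖ *
            ‖ex * (((S ^ (P * k) : ℝ) : ℂ) * h (splitVandermonde l xp xm u)) * D‖) := by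
            have : 0 ≤ ‖Q‖ * S⁻¹ * (‖v‖ *
              ‖ex * (((S ^ (P * k) : ℝ) : ℂ) * h (splitVandermonde l xp xm u)) * D‖) := by
              positivity
            linarith
    · rw [indicator_of_notMem hv, mul_zero, zero_sub, norm_neg, norm_mul]
      -- Outside the box some coordinate exceeds `√N` in absolute value, so the tail can be
      -- multiplied by `‖v‖ / √N` at no loss.
      have h1 : 1 ≤ S⁻¹ * ‖v‖ := by
        by_contra hlt
        refine hv fun i _ => abs_le.mp ?_
        rw [Pi.smul_apply, smul_eq_mul, abs_mul, abs_of_pos (inv_pos.mpr hS)]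
        refine le_trans ?_ (not_le.mp hlt).le
        gcongr
        exact norm_le_pi_norm v i
      calc ‖Q‖ * ‖E v‖ ≤ ‖Q‖ * ‖E v‖ * (S⁻¹ * ‖v‖) :=
            le_mul_of_one_le_right (by positivity) h1
        _ ≤ (C * κ + ‖Q‖) * S⁻¹ * (‖v‖ * ‖E v‖) := by
            have : 0 ≤ C * κ * S⁻¹ * (‖v‖ * ‖E v‖) := by positivity
            linarith
  rw [hscale, contourIntegral, ← hE, ← integral_const_mul, ← integral_sub hΦint (hEint.const_mul Q)]
  refine (norm_integral_le_of_norm_le (hvE.const_mul ((C * κ + ‖Q‖) * S⁻¹)) hpt).trans_eq ?_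
  rw [integral_const_mul]
  ring

end Laplace

/-! ### Splitting the parameter space by symmetry -/

section Regions

variable {n : ℕ}

/-- The parameters `s` with `s₀ < sᵢ` precisely for `i ∈ S`. -/
def sideRegion (s₀ : ℝ) (S : Finset (Fin n)) : Set (Fin n → ℝ) :=
  univ.pi fun i => if i ∈ S then Ioi s₀ else Iic s₀

theorem mem_sideRegion {s₀ : ℝ} {S : Finset (Fin n)} {s : Fin n → ℝ} :
    s ∈ sideRegion s₀ S ↔ ∀ i, i ∈ S ↔ s₀ < s i := by
  simp only [sideRegion, mem_univ_pi]
  refine forall_congr' fun i => ?_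
  split_ifs with h <;> simp [h]

theorem measurableSet_sideRegion (s₀ : ℝ) (S : Finset (Fin n)) :
    MeasurableSet (sideRegion s₀ S) := by
  refine MeasurableSet.univ_pi fun i => ?_
  split_ifs
  · exact measurableSet_Ioi
  · exact measurableSet_Iic

theorem integral_eq_sum_sideRegion (s₀ : ℝ) {f : (Fin n → ℝ) → ℂ} (hf : Integrable f) :
    ∫ s, f s = ∑ S : Finset (Fin n), ∫ s in sideRegion s₀ S, f s := by
  have hU : ⋃ S : Finset (Fin n), sideRegion s₀ S = univ := by
    refine eq_univ_of_forall fun s => mem_iUnion.mpr ⟨Finset.univ.filter fun i => s₀ < s i, ?_⟩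
    simp [mem_sideRegion]
  rw [← setIntegral_univ, ← hU]
  refine integral_iUnion_fintype (fun S => measurableSet_sideRegion s₀ S) ?_
    fun S => hf.integrableOn
  intro S S' hne
  refine Set.disjoint_left.mpr fun s hs hs' => hne ?_
  ext i
  rw [mem_sideRegion.mp hs i, mem_sideRegion.mp hs' i]

/-- The first `l` indices. -/
def firstIndices (n l : ℕ) : Finset (Fin n) := Finset.univ.filter fun i => (i : ℕ) < l

theorem mem_firstIndices {l : ℕ} {i : Fin n} : i ∈ firstIndices n l ↔ (i : ℕ) < l := by
  simp [firstIndices]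

theorem card_firstIndices {l : ℕ} (hl : l ≤ n) : (firstIndices n l).card = l := by
  rw [firstIndices, Fin.card_filter_val_lt, min_eq_right hl]

/-- Any bijection from the first `S.card` indices onto `S` extends to a permutation, and permuting
coordinates preserves volume. -/
theorem setIntegral_sideRegion_eq_of_symm (s₀ : ℝ) {f : (Fin n → ℝ) → ℂ}
    (hf : ∀ (σ : Equiv.Perm (Fin n)) s, f (fun i => s (σ i)) = f s) (S : Finset (Fin n)) :
    ∫ s in sideRegion s₀ S, f s = ∫ s in sideRegion s₀ (firstIndices n S.card), f s := by
  have hcard : S.card ≤ n := by simpa using S.card_le_univ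
  obtain ⟨σ, hσ⟩ : ∃ σ : Equiv.Perm (Fin n), ∀ i, σ i ∈ S ↔ i ∈ firstIndices n S.card := by
    have e : {i // i ∈ firstIndices n S.card} ≃ {i // i ∈ S} :=
      Finset.equivOfCardEq (card_firstIndices hcard)
    refine ⟨e.extendSubtype, fun i => ⟨fun h => ?_, fun h => e.extendSubtype_mem i h⟩⟩
    by_contra hi
    exact e.extendSubtype_not_mem i hi h
  have hmp := volume_measurePreserving_piCongrLeft (fun _ : Fin n => ℝ) σ
  have happ : ∀ (s : Fin n → ℝ), MeasurableEquiv.piCongrLeft (fun _ : Fin n => ℝ) σ s =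
      fun i => s (σ.symm i) := by
    intro s
    funext i
    obtain ⟨j, rfl⟩ := σ.surjective i
    rw [MeasurableEquiv.coe_piCongrLeft, Equiv.piCongrLeft_apply_apply, Equiv.symm_apply_apply]
  rw [← hmp.setIntegral_preimage_emb (MeasurableEquiv.measurableEmbedding _)]
  have hpre : MeasurableEquiv.piCongrLeft (fun _ : Fin n => ℝ) σ ⁻¹' sideRegion s₀ S =
      sideRegion s₀ (firstIndices n S.card) := by
    ext s
    rw [mem_preimage, happ, mem_sideRegion, mem_sideRegion]
    refine σ.symm.forall_congr fun i => ?_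
    rw [← hσ, Equiv.apply_symm_apply]
  rw [hpre]
  refine integral_congr_ae (Eventually.of_forall fun s => ?_)
  simp only [happ]
  exact hf σ.symm s

theorem integral_eq_sum_choose (s₀ : ℝ) {f : (Fin n → ℝ) → ℂ} (hint : Integrable f)
    (hf : ∀ (σ : Equiv.Perm (Fin n)) s, f (fun i => s (σ i)) = f s) :
    ∫ s, f s = ∑ l ∈ Finset.range (n + 1),
      (n.choose l : ℂ) * ∫ s in sideRegion s₀ (firstIndices n l), f s := by
  rw [integral_eq_sum_sideRegion s₀ hint,
    Finset.sum_congr rfl fun S _ => setIntegral_sideRegion_eq_of_symm s₀ hf S,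
    ← Finset.powerset_univ,
    Finset.sum_powerset_apply_card fun l => ∫ s in sideRegion s₀ (firstIndices n l), f s]
  simp

end Regions

/-! ### The integrand along the contour -/

section Selberg

variable {n : ℕ} {p h : ℂ → ℂ} {q : (Fin n → ℂ) → ℂ} {T : Set ℂ} {γ : ℝ → ℂ}

theorem pullback_selbergIntegrand_comp_perm (hh_even : ∀ x, h (-x) = h x)
    (hq_symm : ∀ (σ : Equiv.Perm (Fin n)) (t : Fin n → ℂ), (∀ i, t i ∈ T) →
      q (fun i => t (σ i)) = q t) (hγT : ∀ s, γ s ∈ T) (N : ℝ) (σ : Equiv.Perm (Fin n))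
    (s : Fin n → ℝ) :
    pullback (fun _ => γ) (selbergIntegrand p h q N) (fun i => s (σ i)) =
      pullback (fun _ => γ) (selbergIntegrand p h q N) s := by
  have h1 : h (vandermonde fun i => γ (s (σ i))) = h (vandermonde fun i => γ (s i)) := by
    rcases vandermonde_comp_perm σ fun i => γ (s i) with e | e <;> rw [e]
    exact hh_even _
  rw [pullback, pullback, selbergIntegrand, selbergIntegrand, h1,
    hq_symm σ (fun i => γ (s i)) fun i => hγT _,
    Equiv.sum_comp σ fun i => p (γ (s i)), Equiv.prod_comp σ fun i => deriv γ (s i)]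

/-- Passing from `N₀` to `N` multiplies the integrand by `exp (-(N - N₀) * ∑ p)`, which is bounded
because `Re p` is bounded below on the contour. -/
theorem integrable_pullback_selbergIntegrand (hpγ : Continuous fun s => p (γ s)) {m : ℝ}
    (hm : ∀ s, m ≤ (p (γ s)).re) {N₀ N : ℝ} (hN : N₀ ≤ N)
    (hint : Integrable (pullback (fun _ : Fin n => γ) (selbergIntegrand p h q N₀))) :
    Integrable (pullback (fun _ : Fin n => γ) (selbergIntegrand p h q N)) := by
  have e : pullback (fun _ : Fin n => γ) (selbergIntegrand p h q N) = fun s =>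
      Complex.exp (-((N - N₀ : ℝ) : ℂ) * ∑ i, p (γ (s i))) *
        pullback (fun _ : Fin n => γ) (selbergIntegrand p h q N₀) s := by
    funext s
    have : -(N : ℂ) * ∑ i, p (γ (s i)) =
        -((N - N₀ : ℝ) : ℂ) * ∑ i, p (γ (s i)) + -(N₀ : ℂ) * ∑ i, p (γ (s i)) := by
      push_cast; ring
    rw [pullback, pullback, selbergIntegrand, selbergIntegrand, this, Complex.exp_add]
    ring
  rw [e]
  refine hint.bdd_mul (c := Real.exp (-((N - N₀) * ∑ i : Fin n, m)))
    (Continuous.aestronglyMeasurable ?_) (Eventually.of_forall fun s => ?_)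
  · refine Complex.continuous_exp.comp (continuous_const.mul ?_)
    exact continuous_finsetSum _ fun i _ => hpγ.comp (continuous_apply i)
  · rw [Complex.norm_exp, ← Complex.ofReal_neg, Complex.re_ofReal_mul, Complex.re_sum, neg_mul]
    have : ∑ i : Fin n, m ≤ ∑ i, (p (γ (s i))).re := Finset.sum_le_sum fun i _ => hm _
    have hN' : 0 ≤ N - N₀ := by linarith
    gcongr

theorem selbergIntegrand_eq (x : Fin n → ℂ) (N : ℝ) (t : Fin n → ℂ) :
    selbergIntegrand p h q N t =
      Complex.exp (-(N : ℂ) * ∑ i, p (x i)) * normalizedIntegrand p h q x N t := by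
  have : -(N : ℂ) * ∑ i, p (t i) =
      -(N : ℂ) * ∑ i, p (x i) + -(N : ℂ) * ∑ i, (p (t i) - p (x i)) := by
    rw [Finset.sum_sub_distrib]; ring
  rw [selbergIntegrand, normalizedIntegrand, this, Complex.exp_add]
  ring

theorem sum_apply_saddlePoint {l : ℕ} (hl : l ≤ n) (xp xm : ℂ) :
    ∑ i : Fin n, p (saddlePoint l xp xm i) = (l : ℂ) * p xp + ((n : ℂ) - l) * p xm := by
  have h1 : ∀ i : Fin n, p (saddlePoint l xp xm i) = if (i : ℕ) < l then p xp else p xm := by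
    intro i
    rw [saddlePoint]
    split_ifs <;> rfl
  obtain ⟨m, rfl⟩ := Nat.exists_eq_add_of_le hl
  rw [Finset.sum_congr rfl fun i _ => h1 i,
    Fin.sum_univ_eq_sum_range (fun i => if i < l then p xp else p xm) (l + m),
    Finset.sum_range_add, Finset.sum_congr rfl (g := fun _ => p xp)
      fun i hi => if_pos (Finset.mem_range.mp hi)]
  simp

theorem exists_pos_le_of_isCompact {φ : ℝ → ℝ} (hφ : Continuous φ) {J K : Set ℝ}
    (hJ : IsClosed J) (hK : IsCompact K) {s τ₁ τ₂ η : ℝ} (hη : 0 < η) (h₁ : τ₁ < s) (h₂ : s < τ₂)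
    (hpos : ∀ u ∈ J, u ≠ s → 0 < φ u) (hend : ∀ u ∈ J, u ∉ K → η ≤ φ u) :
    ∃ η' > 0, ∀ u ∈ J, u ∉ Icc τ₁ τ₂ → η' ≤ φ u := by
  -- Removing the open interval keeps the set compact while excluding the zero `s` of `φ`.
  have hc : IsCompact ((K ∩ J) \ Ioo τ₁ τ₂) := (hK.inter_right hJ).diff isOpen_Ioo
  obtain ⟨b, hb, hbK⟩ := hc.exists_forall_le' hφ.continuousOn (a := 0) fun u hu =>
    hpos u hu.1.2 fun e => hu.2 (e ▸ ⟨h₁, h₂⟩)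
  refine ⟨min b η, lt_min hb hη, fun u hu hτ => ?_⟩
  by_cases huK : u ∈ K
  · exact (min_le_left _ _).trans (hbK u ⟨⟨huK, hu⟩, fun hI => hτ (Ioo_subset_Icc_self hI)⟩)
  · exact (min_le_right _ _).trans (hend u hu huK)

end Selberg

/-- The quadratic form at `κ₁`, `κ₂` equals `p (γ τ) - p (γ s)`. Positivity of the real part on the
contour is therefore exactly the Gaussian decay along the half-lines. -/
theorem IsSaddleRays.exists_inverse {T : Set ℂ} {p : ℂ → ℂ} {γ : ℝ → ℂ} {J : Set ℝ} {s : ℝ}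
    {κ₁ κ₂ : ℂ} (hκ : IsSaddleRays T p γ J s κ₁ κ₂) (h2 : deriv (deriv p) (γ s) ≠ 0)
    (hJ : ∀ u ∈ J, u ≠ s → 0 < (p (γ u) - p (γ s)).re) :
    ∃ (ρ : ℝ) (V : Set ℂ) (t : ℂ → ℂ) (τ₁ τ₂ : ℝ), IsSaddleInverse p (γ s) ρ V t ∧
      Metric.ball (γ s) ρ ⊆ T ∧ Metric.closedBall 0 (max ‖κ₁‖ ‖κ₂‖) ⊆ V ∧ τ₁ < s ∧ s < τ₂ ∧
      Icc τ₁ τ₂ ⊆ J ∧ MapsTo γ (Icc τ₁ τ₂) (Metric.ball (γ s) ρ) ∧ γ τ₁ = t κ₁ ∧ γ τ₂ = t κ₂ ∧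
      0 < (deriv (deriv p) (γ s) / 2 * κ₁ ^ 2).re ∧
      0 < (deriv (deriv p) (γ s) / 2 * κ₂ ^ 2).re := by
  obtain ⟨ρ, w, τ₁, τ₂, hw, h₁, h₂, hτJ, hmaps, hκ₁, hκ₂, hball⟩ := hκ
  obtain ⟨t, ht, htw⟩ := hw.exists_inverse h2
  have m₁ : τ₁ ∈ Icc τ₁ τ₂ := left_mem_Icc.mpr (h₁.trans h₂).le
  have m₂ : τ₂ ∈ Icc τ₁ τ₂ := right_mem_Icc.mpr (h₁.trans h₂).le
  have hre : ∀ τ ∈ Icc τ₁ τ₂, τ ≠ s → 0 < (deriv (deriv p) (γ s) / 2 * w (γ τ) ^ 2).re := by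
    intro τ hτ hne
    have e : deriv (deriv p) (γ s) / 2 * w (γ τ) ^ 2 = p (γ τ) - p (γ s) := by
      rw [hw.sq_eq _ (hmaps hτ)]
      field_simp
    rw [e]
    exact hJ τ (hτJ hτ) hne
  refine ⟨ρ, _, t, τ₁, τ₂, ht, hw.ball_subset, hball, h₁, h₂, hτJ, hmaps, ?_, ?_, ?_, ?_⟩
  · rw [hκ₁, htw _ (hmaps m₁)]
  · rw [hκ₂, htw _ (hmaps m₂)]
  · rw [hκ₁]; exact hre _ m₁ h₁.ne
  · rw [hκ₂]; exact hre _ m₂ h₂.ne'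

/-! ### Asymptotics of one region -/

section SelbergAsymptotics

variable {n k : ℕ} {T : Set ℂ} {p h : ℂ → ℂ} {q : (Fin n → ℂ) → ℂ} {A : ℂ}
  {a b : OnePoint ℂ} {γ : ℝ → ℂ} {sm s0 sp N₀ : ℝ} {κp₁ κp₂ κm₁ κm₂ : ℂ}

theorem norm_pullback_normalizedIntegrand_le {x : Fin n → ℂ} {η N : ℝ} (hN : N₀ ≤ N)
    {s : Fin n → ℝ} (hs : η ≤ ∑ i, (p (γ (s i)) - p (x i)).re) :
    ‖pullback (fun _ => γ) (normalizedIntegrand p h q x N) s‖ ≤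
      Real.exp (-((N - N₀) * η)) *
        ‖pullback (fun _ => γ) (normalizedIntegrand p h q x N₀) s‖ := by
  have e : pullback (fun _ => γ) (normalizedIntegrand p h q x N) s =
      Complex.exp (-((N - N₀ : ℝ) : ℂ) * ∑ i, (p (γ (s i)) - p (x i))) *
        pullback (fun _ => γ) (normalizedIntegrand p h q x N₀) s := by
    have : -(N : ℂ) * ∑ i, (p (γ (s i)) - p (x i)) =
        -((N - N₀ : ℝ) : ℂ) * ∑ i, (p (γ (s i)) - p (x i)) +
          -(N₀ : ℂ) * ∑ i, (p (γ (s i)) - p (x i)) := by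
      push_cast; ring
    rw [pullback, pullback, normalizedIntegrand, normalizedIntegrand, this, Complex.exp_add]
    ring
  rw [e, norm_mul, Complex.norm_exp, ← Complex.ofReal_neg, Complex.re_ofReal_mul, Complex.re_sum,
    neg_mul]
  have hN' : 0 ≤ N - N₀ := by linarith
  gcongr

/-- The term with `C` is Laplace's error on the box around the saddle point. The term with `D` is
the rest of the region, compared with the absolutely convergent integral at `N₀`. -/
theorem exists_norm_regionIntegral_sub_le (hT : IsOpen T) (hp : DifferentiableOn ℂ p T)
    (hq : DifferentiableOn ℂ q {t | ∀ i, t i ∈ T}) (hh : Differentiable ℂ h)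
    (hA : ∀ x, h x = A * x ^ k) (hγ : IsContour γ a b) (hγT : ∀ s, γ s ∈ T)
    (hne : γ sp ≠ γ sm) (hp''_p : deriv (deriv p) (γ sp) ≠ 0)
    (hp''_m : deriv (deriv p) (γ sm) ≠ 0)
    (hconv : ∀ N ≥ N₀, Integrable (pullback (fun _ : Fin n => γ) (selbergIntegrand p h q N)))
    (hre_m : ∀ s ≤ s0, s ≠ sm → 0 < (p (γ s) - p (γ sm)).re)
    (hre_p : ∀ s ≥ s0, s ≠ sp → 0 < (p (γ s) - p (γ sp)).re)
    (hend_m : ∃ η > 0, ∀ᶠ s in atBot, η ≤ (p (γ s) - p (γ sm)).re)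
    (hend_p : ∃ η > 0, ∀ᶠ s in atTop, η ≤ (p (γ s) - p (γ sp)).re)
    (hκp : IsSaddleRays T p γ (Ioi s0) sp κp₁ κp₂) (hκm : IsSaddleRays T p γ (Iio s0) sm κm₁ κm₂)
    {l : ℕ} (hl : l ≤ n) :
    Integrable (pullback (splitContours l (rayContour κp₁ κp₂) (rayContour κm₁ κm₂))
      (gaussIntegrand (n := n) h (γ sp) (γ sm) (deriv (deriv p) (γ sp))
        (deriv (deriv p) (γ sm)) l)) ∧
    ∃ C D η : ℝ, 0 < η ∧ ∀ N : ℝ, 0 < N → N₀ ≤ N →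
      ‖((√N ^ ((l.choose 2 + (n - l).choose 2) * k + n) : ℝ) : ℂ) *
        (∫ s in sideRegion s0 (firstIndices n l), pullback (fun _ => γ)
          (normalizedIntegrand p h q (saddlePoint l (γ sp) (γ sm)) N) s) -
        q (saddlePoint l (γ sp) (γ sm)) *
          contourIntegral (splitContours l (rayContour κp₁ κp₂) (rayContour κm₁ κm₂))
            (gaussIntegrand (n := n) h (γ sp) (γ sm) (deriv (deriv p) (γ sp))
              (deriv (deriv p) (γ sm)) l)‖ ≤
      C * (√N)⁻¹ + D * (√N ^ ((l.choose 2 + (n - l).choose 2) * k + n) *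
        Real.exp (-((N - N₀) * η))) := by
  obtain ⟨ρp, Vp, tp, τp₁, τp₂, ip, bp, rp, hp₁, hp₂, Jp, mp, ep₁, ep₂, rep₁, rep₂⟩ :=
    hκp.exists_inverse hp''_p fun u hu => hre_p u (le_of_lt hu)
  obtain ⟨ρm, Vm, tm, τm₁, τm₂, im, bm, rm, hm₁, hm₂, Jm, mm, em₁, em₂, rem₁, rem₂⟩ :=
    hκm.exists_inverse hp''_m fun u hu => hre_m u (le_of_lt hu)
  refine ⟨integrable_pullback_gaussIntegrand hA rep₁ rep₂ rem₁ rem₂, ?_⟩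
  obtain ⟨C, hC⟩ := exists_norm_localIntegral_sub_le ip im rp rm hne hl hT bp bm hp hh hq hA
    rep₁ rep₂ rem₁ rem₂
  have hpγ : Continuous fun s => p (γ s) :=
    continuous_iff_continuousAt.mpr fun s => ContinuousAt.comp (g := p)
      (hp.differentiableAt (hT.mem_nhds (hγT s))).continuousAt hγ.continuous.continuousAt
  obtain ⟨ηp, hηp, hfar_p⟩ : ∃ η > 0, ∀ u ∈ Ici s0, u ∉ Icc τp₁ τp₂ →
      η ≤ (p (γ u) - p (γ sp)).re := by
    obtain ⟨η, hη, hev⟩ := hend_p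
    obtain ⟨M, hM⟩ := eventually_atTop.mp hev
    refine exists_pos_le_of_isCompact (Complex.continuous_re.comp (hpγ.sub continuous_const))
      isClosed_Ici (isCompact_Icc (a := s0) (b := M)) hη hp₁ hp₂ hre_p fun u hu hK => hM u ?_
    by_contra hlt
    exact hK ⟨hu, (not_le.mp hlt).le⟩
  obtain ⟨ηm, hηm, hfar_m⟩ : ∃ η > 0, ∀ u ∈ Iic s0, u ∉ Icc τm₁ τm₂ →
      η ≤ (p (γ u) - p (γ sm)).re := by
    obtain ⟨η, hη, hev⟩ := hend_m
    obtain ⟨M, hM⟩ := eventually_atBot.mp hev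
    refine exists_pos_le_of_isCompact (Complex.continuous_re.comp (hpγ.sub continuous_const))
      isClosed_Iic (isCompact_Icc (a := M) (b := s0)) hη hm₁ hm₂ hre_m fun u hu hK => hM u ?_
    by_contra hlt
    exact hK ⟨(not_le.mp hlt).le, hu⟩
  set x : Fin n → ℂ := saddlePoint l (γ sp) (γ sm) with hx
  set α : Fin n → ℝ := fun i => if (i : ℕ) < l then τp₁ else τm₁ with hα
  set β : Fin n → ℝ := fun i => if (i : ℕ) < l then τp₂ else τm₂ with hβ
  set box : Set (Fin n → ℝ) := univ.pi fun i => Icc (α i) (β i) with hbox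
  set region := sideRegion s0 (firstIndices n l) with hregion
  have hboxm : MeasurableSet box := MeasurableSet.univ_pi fun _ => measurableSet_Icc
  have hsub : box ⊆ region := by
    intro s hs
    refine mem_sideRegion.mpr fun i => ?_
    have hsi := hs i (mem_univ i)
    rw [mem_firstIndices]
    by_cases hi : (i : ℕ) < l
    · simp only [hα, hβ, if_pos hi] at hsi
      simpa [hi] using Jp hsi
    · simp only [hα, hβ, if_neg hi] at hsi
      simpa [hi] using (mem_Iio.mp (Jm hsi)).le
  have hre : ∀ s ∈ region, ∀ i, 0 ≤ (p (γ (s i)) - p (x i)).re ∧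
      (s i ∉ Icc (α i) (β i) → min ηp ηm ≤ (p (γ (s i)) - p (x i)).re) := by
    intro s hs i
    have hsi := mem_sideRegion.mp hs i
    rw [mem_firstIndices] at hsi
    by_cases hi : (i : ℕ) < l
    · have h0 : s0 < s i := hsi.mp hi
      simp only [hα, hβ, hx, saddlePoint, if_pos hi]
      refine ⟨?_, fun hn => (min_le_left _ _).trans (hfar_p _ h0.le hn)⟩
      by_cases e : s i = sp
      · rw [e, sub_self, Complex.zero_re]
      · exact (hre_p _ h0.le e).le
    · have h0 : s i ≤ s0 := not_lt.mp fun h0 => hi (hsi.mpr h0)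
      simp only [hα, hβ, hx, saddlePoint, if_neg hi]
      refine ⟨?_, fun hn => (min_le_right _ _).trans (hfar_m _ h0 hn)⟩
      by_cases e : s i = sm
      · rw [e, sub_self, Complex.zero_re]
      · exact (hre_m _ h0 e).le
  -- One coordinate outside its interval contributes the full gap, and no other coordinate
  -- contributes negatively.
  have hfar : ∀ s ∈ region \ box, min ηp ηm ≤ ∑ i, (p (γ (s i)) - p (x i)).re := by
    rintro s ⟨hs, hsb⟩
    obtain ⟨i, hi⟩ : ∃ i, s i ∉ Icc (α i) (β i) := by
      by_contra! hall
      exact hsb fun i _ => hall i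
    exact ((hre s hs i).2 hi).trans (Finset.single_le_sum
      (f := fun i => (p (γ (s i)) - p (x i)).re) (fun j _ => (hre s hs j).1) (Finset.mem_univ i))
  have hint : ∀ N ≥ N₀, Integrable
      (pullback (fun _ : Fin n => γ) (normalizedIntegrand p h q x N)) := by
    intro N hN
    have e : pullback (fun _ : Fin n => γ) (normalizedIntegrand p h q x N) = fun s =>
        (Complex.exp (-(N : ℂ) * ∑ i, p (x i)))⁻¹ *
          pullback (fun _ : Fin n => γ) (selbergIntegrand p h q N) s := by
      funext s
      rw [pullback, pullback, selbergIntegrand_eq x, mul_assoc,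
        inv_mul_cancel_left₀ (Complex.exp_ne_zero _)]
    rw [e]
    exact (hconv N hN).const_mul _
  have hsubT : {t : Fin n → ℂ | ∀ i, t i ∈ Metric.ball (x i) (if (i : ℕ) < l then ρp else ρm)} ⊆
      {t | ∀ i, t i ∈ T} := by
    intro t ht i
    have := ht i
    rw [hx, saddlePoint] at this
    split_ifs at this
    · exact bp this
    · exact bm this
  have hlocal : ∀ N : ℝ, ∫ s in box, pullback (fun _ => γ) (normalizedIntegrand p h q x N) s =
      ∫ v in univ.pi fun _ : Fin n => Icc (-1 : ℝ) 1,
        pullback (localContours n l tp tm κp₁ κp₂ κm₁ κm₂) (normalizedIntegrand p h q x N) v := by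
    intro N
    refine setIntegral_pullback_congr (fun i => ?_)
      (fun i => ip.isPathIn_localContours im rp rm i) (fun i => ?_) (fun i => ?_)
      ((differentiableOn_normalizedIntegrand hp hh hq x N).mono hsubT)
    · simp only [hα, hβ, saddlePoint]
      split_ifs
      · exact hγ.isPathIn (hp₁.trans hp₂).le mp
      · exact hγ.isPathIn (hm₁.trans hm₂).le mm
    · simp only [hα, localContours, splitMap, splitContours]
      split_ifs
      · simp [rayContour, ep₁]
      · simp [rayContour, em₁]
    · simp only [hβ, localContours, splitMap, splitContours]
      have h1 : ¬ (1 : ℝ) ≤ 0 := by norm_num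
      split_ifs
      · simp [rayContour, ep₂, h1]
      · simp [rayContour, em₂, h1]
  refine ⟨C, ∫ s in region \ box,
    ‖pullback (fun _ => γ) (normalizedIntegrand p h q x N₀) s‖, min ηp ηm, lt_min hηp hηm,
    fun N hN hNN => ?_⟩
  have hrest : ‖∫ s in region \ box, pullback (fun _ => γ) (normalizedIntegrand p h q x N) s‖ ≤
      Real.exp (-((N - N₀) * min ηp ηm)) * ∫ s in region \ box,
        ‖pullback (fun _ => γ) (normalizedIntegrand p h q x N₀) s‖ := by
    rw [← integral_const_mul]
    refine norm_integral_le_of_norm_le (((hint N₀ le_rfl).norm.integrableOn).const_mul _) ?_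
    refine (ae_restrict_iff' ((measurableSet_sideRegion _ _).diff hboxm)).mpr
      (Eventually.of_forall fun s hs => ?_)
    exact norm_pullback_normalizedIntegrand_le hNN (hfar s hs)
  have hsplit : ∫ s in region, pullback (fun _ => γ) (normalizedIntegrand p h q x N) s =
      (∫ s in box, pullback (fun _ => γ) (normalizedIntegrand p h q x N) s) +
      ∫ s in region \ box, pullback (fun _ => γ) (normalizedIntegrand p h q x N) s := by
    rw [← setIntegral_union disjoint_sdiff_right ((measurableSet_sideRegion _ _).diff hboxm)
      (hint N hNN).integrableOn (hint N hNN).integrableOn, union_sdiff_cancel hsub]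
  rw [hsplit, hlocal, mul_add, add_sub_right_comm]
  refine (norm_add_le _ _).trans (add_le_add (hC N hN) ?_)
  rw [norm_mul, Complex.norm_real, Real.norm_of_nonneg (by positivity)]
  calc _ ≤ √N ^ ((l.choose 2 + (n - l).choose 2) * k + n) *
        (Real.exp (-((N - N₀) * min ηp ηm)) * ∫ s in region \ box,
          ‖pullback (fun _ => γ) (normalizedIntegrand p h q x N₀) s‖) := by gcongr
    _ = _ := by ring

end SelbergAsymptotics

/-! ### Error terms and conclusion -/

theorem isBigO_of_norm_le {R : ℝ → ℂ} {C D η N₀ : ℝ} {m : ℕ} (hη : 0 < η)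
    (hR : ∀ N : ℝ, 0 < N → N₀ ≤ N →
      ‖R N‖ ≤ C * (√N)⁻¹ + D * (√N ^ m * Real.exp (-((N - N₀) * η)))) :
    R =O[atTop] fun N : ℝ => N ^ (-(1 / 2) : ℝ) := by
  have h1 : (fun N : ℝ => C * (√N)⁻¹) =O[atTop] fun N : ℝ => N ^ (-(1 / 2) : ℝ) := by
    refine IsBigO.const_mul_left (EventuallyEq.isBigO ?_) C
    filter_upwards [eventually_ge_atTop 0] with N hN
    rw [Real.rpow_neg hN, Real.sqrt_eq_rpow]
  have h2 : (fun N : ℝ => D * (√N ^ m * Real.exp (-((N - N₀) * η)))) =O[atTop]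
      fun N : ℝ => N ^ (-(1 / 2) : ℝ) := by
    refine IsBigO.const_mul_left ?_ D
    -- The exponent is chosen so that multiplication by `√N ^ m = N ^ (m / 2)` leaves `N ^ (-1 /
    -- 2)`.
    have h3 := (isLittleO_exp_neg_mul_rpow_atTop hη (-((m : ℝ) / 2) - 1 / 2)).isBigO
    have h4 := (isBigO_refl (fun N : ℝ => √N ^ m * Real.exp (N₀ * η)) atTop).mul h3
    refine h4.congr' ?_ ?_ |>.trans (isBigO_const_mul_self (Real.exp (N₀ * η)) _ _)
    · refine Eventually.of_forall fun N => ?_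
      have : -((N - N₀) * η) = N₀ * η + -η * N := by ring
      simp only []
      rw [this, Real.exp_add]
      ring
    · filter_upwards [eventually_gt_atTop 0] with N hN
      have e : √N ^ m = N ^ ((m : ℝ) / 2) := by
        rw [Real.rpow_div_two_eq_sqrt _ hN.le, Real.rpow_natCast]
      rw [e, mul_right_comm, ← Real.rpow_add hN, mul_comm]
      congr 2
      ring
  refine IsBigO.trans ?_ (h1.add h2)
  refine IsBigO.of_bound 1 ?_
  filter_upwards [eventually_gt_atTop 0, eventually_ge_atTop N₀] with N hN hN₀
  rw [one_mul]
  exact (hR N hN hN₀).trans (le_abs_self _)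

theorem exists_relative_or_absolute_error {n : ℕ} {X : ℕ → ℂ} {R : ℕ → ℝ → ℂ}
    (hR : ∀ l ≤ n, (fun N => R l N - X l) =O[atTop] fun N : ℝ => N ^ (-(1 / 2) : ℝ)) :
    ∃ ε δ : ℕ → ℝ → ℂ,
      (∀ l ≤ n, ε l =O[atTop] fun N : ℝ => N ^ (-(1 / 2) : ℝ)) ∧
      (∀ l ≤ n, δ l =O[atTop] fun N : ℝ => N ^ (-(1 / 2) : ℝ)) ∧
      (∀ l ≤ n, X l ≠ 0 → ∀ N, δ l N = 0) ∧
      ∀ l N, R l N = X l * (1 + ε l N) + δ l N := by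
  -- If `X l = 0`, the convention `0⁻¹ = 0` makes `ε l` vanish and `δ l` carries the whole error.
  refine ⟨fun l N => (X l)⁻¹ * (R l N - X l), fun l N => if X l = 0 then R l N - X l else 0,
    fun l hl => (hR l hl).const_mul_left _, fun l hl => ?_, fun l _ hX N => if_neg hX,
    fun l N => ?_⟩
  · by_cases hX : X l = 0
    · simpa only [if_pos hX] using hR l hl
    · simpa only [if_neg hX] using isBigO_zero _ _
  · by_cases hX : X l = 0
    · simp [hX]
    · simp only [if_neg hX]
      field_simp
      ring

theorem theorem3p6 (n : ℕ) (ν : ℝ) (hν : 0 ≤ ν)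
    -- (i) analyticity, homogeneity and symmetry
    (T : Set ℂ) (hT : IsOpen T)
    (p : ℂ → ℂ) (hp : DifferentiableOn ℂ p T)
    (q : (Fin n → ℂ) → ℂ) (hq : DifferentiableOn ℂ q {t | ∀ i, t i ∈ T})
    (hq_symm : ∀ (σ : Equiv.Perm (Fin n)) (t : Fin n → ℂ), (∀ i, t i ∈ T) →
      q (fun i => t (σ i)) = q t)
    (h : ℂ → ℂ) (hh : Differentiable ℂ h)
    (hh_hom : ∀ c x : ℂ, 0 < c.re → h (c * x) = c ^ (ν : ℂ) * h x)
    (hh_even : ∀ x : ℂ, h (-x) = h x)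
    -- (ii) the integration path
    (a b : OnePoint ℂ) (γ : ℝ → ℂ) (hγ : IsContour γ a b) (hγT : ∀ s, γ s ∈ T)
    -- (iii) two simple saddle points at interior points of the path
    (xp xm : ℂ) (hne : xp ≠ xm) (sm s0 sp : ℝ) (hsm : sm < s0) (hsp : s0 < sp)
    (hxp : γ sp = xp) (hxm : γ sm = xm)
    (hp'_p : deriv p xp = 0) (hp'_m : deriv p xm = 0)
    (hp''_p : deriv (deriv p) xp ≠ 0) (hp''_m : deriv (deriv p) xm ≠ 0)
    -- (iv) absolute convergence for some parameter
    (hconv : ∃ N₀ : ℝ, 0 < N₀ ∧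
      Integrable (pullback (fun _ : Fin n => γ) (selbergIntegrand p h q N₀)))
    -- (v) the real part of p along the path
    (hre_m : ∀ s ≤ s0, s ≠ sm → 0 < (p (γ s) - p xm).re)
    (hre_p : ∀ s ≥ s0, s ≠ sp → 0 < (p (γ s) - p xp).re)
    (hend_m : ∃ η > 0, ∀ᶠ s in atBot, η ≤ (p (γ s) - p xm).re)
    (hend_p : ∃ η > 0, ∀ᶠ s in atTop, η ≤ (p (γ s) - p xp).re) :
    -- straight lines as in the definition of the constants exist at both saddle points
    (∃ κ₁ κ₂ : ℂ, IsSaddleRays T p γ (Ioi s0) sp κ₁ κ₂) ∧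
    (∃ κ₁ κ₂ : ℂ, IsSaddleRays T p γ (Iio s0) sm κ₁ κ₂) ∧
    -- the integrals are absolutely convergent for all large N
    (∀ᶠ N : ℝ in atTop,
      Integrable (pullback (fun _ : Fin n => γ) (selbergIntegrand p h q N))) ∧
    -- for every admissible choice of the lines, the asymptotic formula holds
    ∀ κp₁ κp₂ κm₁ κm₂ : ℂ,
      IsSaddleRays T p γ (Ioi s0) sp κp₁ κp₂ → IsSaddleRays T p γ (Iio s0) sm κm₁ κm₂ →
      ∀ (Q B : ℕ → ℂ),
        (∀ l, Q l = q (saddlePoint l xp xm)) →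
        (∀ l, B l = contourIntegral
          (splitContours l (rayContour κp₁ κp₂) (rayContour κm₁ κm₂))
          (gaussIntegrand (n := n) h xp xm (deriv (deriv p) xp) (deriv (deriv p) xm) l)) →
        (∀ l ≤ n, Integrable (pullback
          (splitContours l (rayContour κp₁ κp₂) (rayContour κm₁ κm₂))
          (gaussIntegrand (n := n) h xp xm (deriv (deriv p) xp) (deriv (deriv p) xm) l))) ∧
        ∃ ε δ : ℕ → ℝ → ℂ,
          (∀ l ≤ n, ε l =O[atTop] fun N : ℝ => N ^ (-(1 / 2) : ℝ)) ∧
          (∀ l ≤ n, δ l =O[atTop] fun N : ℝ => N ^ (-(1 / 2) : ℝ)) ∧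
          (∀ l ≤ n, Q l * B l ≠ 0 → ∀ N, δ l N = 0) ∧
          ∀ᶠ N : ℝ in atTop,
            contourIntegral (fun _ : Fin n => γ) (selbergIntegrand p h q N) =
              ∑ l ∈ Finset.range (n + 1), (n.choose l : ℂ) *
                Complex.exp (-(N : ℂ) * ((l : ℂ) * p xp + ((n : ℂ) - (l : ℂ)) * p xm)) *
                ((N ^ (-((nuPairs ν l + nuPairs ν ((n : ℝ) - (l : ℝ)) + (n : ℝ)) / 2)) : ℝ) : ℂ) *
                (Q l * B l * (1 + ε l N) + δ l N) := by
  subst hxp hxm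
  obtain ⟨A, k, hAk, hA⟩ := homogeneous_entire_eq_monomial hh hh_hom
  have hpγ : Continuous fun s => p (γ s) :=
    continuous_iff_continuousAt.mpr fun s => ContinuousAt.comp (g := p)
      (hp.differentiableAt (hT.mem_nhds (hγT s))).continuousAt hγ.continuous.continuousAt
  obtain ⟨N₀, -, hN₀⟩ := hconv
  -- On each side of `s0` the real part of `p` is smallest at the saddle point.
  have hlow : ∀ s, min (p (γ sp)).re (p (γ sm)).re ≤ (p (γ s)).re := by
    intro s
    rcases le_total s s0 with hs | hs
    · refine (min_le_right _ _).trans ?_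
      by_cases e : s = sm
      · rw [e]
      · have := hre_m s hs e
        rw [Complex.sub_re] at this
        linarith
    · refine (min_le_left _ _).trans ?_
      by_cases e : s = sp
      · rw [e]
      · have := hre_p s hs e
        rw [Complex.sub_re] at this
        linarith
  have hint : ∀ N ≥ N₀, Integrable (pullback (fun _ : Fin n => γ) (selbergIntegrand p h q N)) :=
    fun N hN => integrable_pullback_selbergIntegrand hpγ hlow hN hN₀
  refine ⟨exists_isSaddleRays hT hp (hγT sp) hp'_p hp''_p hγ.continuous (Ioi_mem_nhds hsp),
    exists_isSaddleRays hT hp (hγT sm) hp'_m hp''_m hγ.continuous (Iio_mem_nhds hsm),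
    (eventually_ge_atTop N₀).mono hint, ?_⟩
  intro κp₁ κp₂ κm₁ κm₂ hκp hκm Q B hQ hB
  have hmain := fun l (hl : l ≤ n) => exists_norm_regionIntegral_sub_le hT hp hq hh hA hγ hγT hne
    hp''_p hp''_m hint hre_m hre_p hend_m hend_p hκp hκm hl
  refine ⟨fun l hl => (hmain l hl).1, ?_⟩
  set d : ℕ → ℕ := fun l => (l.choose 2 + (n - l).choose 2) * k + n with hd
  set I : ℕ → ℝ → ℂ := fun l N => ∫ s in sideRegion s0 (firstIndices n l),
    pullback (fun _ => γ) (normalizedIntegrand p h q (saddlePoint l (γ sp) (γ sm)) N) s with hI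
  obtain ⟨ε, δ, hε, hδ, hδ0, hR⟩ := exists_relative_or_absolute_error (n := n)
    (X := fun l => Q l * B l) (R := fun l N => ((√N ^ d l : ℝ) : ℂ) * I l N) fun l hl => by
      obtain ⟨-, C, D, η, hη, hbd⟩ := hmain l hl
      refine isBigO_of_norm_le (C := C) (D := D) (N₀ := N₀) (m := d l) hη
        fun N hN hNN => ?_
      rw [hQ, hB]
      exact hbd N hN hNN
  refine ⟨ε, δ, hε, hδ, hδ0, ?_⟩
  filter_upwards [eventually_gt_atTop 0, eventually_ge_atTop N₀] with N hN hNN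
  rw [contourIntegral, integral_eq_sum_choose s0 (hint N hNN)
    (pullback_selbergIntegrand_comp_perm hh_even hq_symm hγT N)]
  refine Finset.sum_congr rfl fun l hl => ?_
  have hl' : l ≤ n := Nat.lt_succ_iff.mp (Finset.mem_range.mp hl)
  rw [← hR l N, mul_assoc, mul_assoc]
  congr 1
  have hfac : ∫ s in sideRegion s0 (firstIndices n l),
      pullback (fun _ => γ) (selbergIntegrand p h q N) s =
      Complex.exp (-(N : ℂ) * ((l : ℂ) * p (γ sp) + ((n : ℂ) - (l : ℂ)) * p (γ sm))) * I l N := by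
    rw [hI, ← integral_const_mul]
    refine integral_congr_ae (Eventually.of_forall fun s => ?_)
    simp only [pullback]
    rw [selbergIntegrand_eq (saddlePoint l (γ sp) (γ sm)), sum_apply_saddlePoint hl', mul_assoc]
  rw [hfac]
  congr 1
  -- If `A = 0`, then `ν` need not be an integer and the power of `N` cannot be matched, but both
  -- sides are zero.
  rcases hAk with hA0 | hk
  · have hI0 : I l N = 0 := by
      simp [hI, pullback, normalizedIntegrand, hA, hA0]
    rw [hI0, mul_zero, mul_zero]
  · have hpow : N ^ (-((nuPairs ν l + nuPairs ν ((n : ℝ) - (l : ℝ)) + (n : ℝ)) / 2)) =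
        (√N ^ d l)⁻¹ := by
      rw [← hk, nuPairs_eq_choose hl', ← Nat.cast_add, Real.rpow_neg hN.le,
        Real.rpow_div_two_eq_sqrt _ hN.le, Real.rpow_natCast]
    have hne0 : ((√N ^ d l : ℝ) : ℂ) ≠ 0 := by
      exact_mod_cast pow_ne_zero _ (Real.sqrt_pos.mpr hN).ne'
    rw [hpow, Complex.ofReal_inv, inv_mul_cancel_left₀ hne0]
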